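/- Let $\sigma\in(0,1)$, $\Lambda\ge 1$, $g\ge 0$ and $0<\epsilon<1$. Let $\mathfrak h=L^2(\{(k,\tau)\in\mathbb R^3\times\{+,-\}:\sigma/\Lambda\le|k|\le 1\};\mathbb C)$ (Lebesgue measure in $k$, summed over $\tau$). Let $\varepsilon(\cdot,\pm):\mathbb R^3\to\mathbb S^2$ be measurable and such that for almost every $k$ the vectors $\varepsilon(k,+),\varepsilon(k,-)$ are orthogonal to $k$ and to each other, and put $G_\nu(k,\tau)=g|k|^{-1/2}\varepsilon_\nu(k,\tau)$, $\nu=1,2,3$. Functions of $k$ also denote the corresponding multiplication operators on $\mathfrak h$. Let $\mathrm{HS}_\epsilon$ be the set of self-adjoint Hilbert–Schmidt operators $z$ on $\mathfrak h$ with $z\ge-\epsilon$. For $z\in\mathrm{HS}_\epsilon$, $\eta\in\mathfrak h$ let $$\mathcal G(z,\eta)=\frac{\Lambda^2}{2}\sum_{\nu=1}^3\langle G_\nu+k_\nu\eta,(1+z)^{-1}(G_\nu+k_\nu\eta)\rangle+\frac{\Lambda}{4}\mathrm{Tr}\big[|k|z^2(1+z)^{-1}\big]+\Lambda\langle\eta,|k|\eta\rangle,$$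 $$P_\eta=2\sum_{\nu=1}^3|G_\nu+k_\nu\eta\rangle\langle G_\nu+k_\nu\eta|,\qquad E_{\mathcal G}=\inf\{\mathcal G(z,\eta): z\in\mathrm{HS}_\epsilon,\ \eta\in\mathfrak h\}.$$ Here, for $z\in\mathrm{HS}_\epsilon$, the operator $1+z$ is invertible and $|k|z^2(1+z)^{-1}$ is trace class. Then: 1. For every $\eta\in\mathfrak h$ the functional $\mathcal G(\cdot,\eta)$ has a unique minimizer on $\mathrm{HS}_\epsilon$, namely the positive trace-class operator $$z_*(\eta)=|k|^{-1/2}\big(|k|^{1/2}(\Lambda P_\eta+|k|)|k|^{1/2}\big)^{1/2}|k|^{-1/2}-1.$$ 2. For every $z\in\mathrm{HS}_\epsilon$ the functional $\mathcal G(z,\cdot)$ has a unique minimizer on $\mathfrak h$, namely $$\eta_*(z)=-\Big(2\Lambda|k|+\Lambda^2\sum_{\nu=1}^3k_\nu(1+z)^{-1}k_\nu\Big)^{-1}\Big(\Lambda^2\sum_{\nu=1}^3k_\nu(1+z)^{-1}G_\nu\Big),$$ where the inverted operator is indeed boundedly invertible. 3. Every minimizing pair $(z,\eta)$ of $\mathcal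 G$ on $\mathrm{HS}_\epsilon\times\mathfrak h$ satisfies $(z,\eta)=(z_*(\eta),\eta_*(z))$. 4. $\mathcal G$ is bounded below on $\mathrm{HS}_\epsilon\times\mathfrak h$, and $E_{\mathcal G}=\inf\{\mathcal G(z_*(\eta),\eta):\eta\in\mathfrak h\}$. 5. For every $\eta\in\mathfrak h$ the operator $(\Lambda|k|^{1/2}P_\eta|k|^{1/2}+|k|^2)^{1/2}-|k|$ is trace class and $$\mathcal G(z_*(\eta),\eta)=\frac{\Lambda}{2}\mathrm{Tr}\Big[\big(\Lambda|k|^{1/2}P_\eta|k|^{1/2}+|k|^2\big)^{1/2}-|k|\Big]+\Lambda\langle\eta,|k|\eta\rangle.$$ -/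

import Mathlib

open MeasureTheory
open scoped ENNReal InnerProductSpace

noncomputable section

namespace BHF

/-! ### Hilbert-Schmidt operators, trace-class operators and the trace -/

section Trace

variable {H : Type*} [NormedAddCommGroup H] [InnerProductSpace ℂ H] [CompleteSpace H]

variable (H) in
/-- The index set of a fixed orthonormal basis of `H`. -/
def basisSet : Set H := (exists_hilbertBasis ℂ H).choose

variable (H) in
/-- A fixed orthonormal (Hilbert) basis of `H`. None of the notions below depends on its choice. -/
def stdBasis : HilbertBasis (basisSet H) ℂ H := (exists_hilbertBasis ℂ H).choose_spec.choose

/-- `Tr A < ∞` for a positive operator `A`. -/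
def FiniteTrace (A : H →L[ℂ] H) : Prop :=
  Summable fun i => (⟪stdBasis H i, A (stdBasis H i)⟫_ℂ).re

/-- `z` is Hilbert-Schmidt: `Tr (z* z) < ∞`. -/
def IsHilbertSchmidt (z : H →L[ℂ] H) : Prop := FiniteTrace (star z * z)

/-- `A` is trace class: `Tr |A| < ∞` with `|A| = (A* A)^{1/2}`. -/
def IsTraceClass (A : H →L[ℂ] H) : Prop := FiniteTrace (CFC.abs A)

/-- The trace of a trace-class operator. -/
def trace (A : H →L[ℂ] H) : ℂ := ∑' i, ⟪stdBasis H i, A (stdBasis H i)⟫_ℂ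

/-- The square root `A^{1/2}` of a positive operator `A`. -/
def opSqrt (A : H →L[ℂ] H) : H →L[ℂ] H := CFC.sqrt A

variable (H) in
/-- `HS_δ(H)`: the self-adjoint Hilbert-Schmidt operators `z` with `z ≥ -δ`. -/
def HSge (δ : ℝ) : Set (H →L[ℂ] H) :=
  {z | IsHilbertSchmidt z ∧ IsSelfAdjoint z ∧ -((δ : ℂ) • (1 : H →L[ℂ] H)) ≤ z}

end Trace

/-- `x` belongs to `S` and is the unique point of `S` at which `f` attains its minimum on `S`. -/
def IsUniqueMinimizer {X : Type*} (f : X → ℝ) (S : Set X) (x : X) : Prop :=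
  x ∈ S ∧ ∀ y ∈ S, y ≠ x → f x < f y

/-! ### The model -/

/-- `ℝ³` with the Euclidean norm. -/
abbrev E3 : Type := EuclideanSpace ℝ (Fin 3)

/-- The parameters of the model: the infrared cutoff `σ ∈ (0,1)`, the ultraviolet cutoff `Λ ≥ 1`,
the coupling constant `g ≥ 0`, and measurable polarization vectors `pol k ±` of length one which,
for almost every `k`, are orthogonal to `k` and to each other. -/
structure Model where
  σ : ℝ
  Λ : ℝ
  g : ℝ
  pol : E3 → Bool → E3
  σ_pos : 0 < σ
  σ_lt_one : σ < 1
  one_le_Λ : 1 ≤ Λ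
  g_nonneg : 0 ≤ g
  measurable_pol : ∀ τ, Measurable fun k => pol k τ
  norm_pol : ∀ k τ, ‖pol k τ‖ = 1
  inner_pol : ∀ᵐ k : E3, ∀ τ, ⟪k, pol k τ⟫_ℝ = 0
  inner_pol_pol : ∀ᵐ k : E3, ⟪pol k true, pol k false⟫_ℝ = 0

namespace Model

variable (M : Model)

/-- The momentum shell `{(k,τ) : σ/Λ ≤ |k| ≤ 1}` in `ℝ³ × {+,-}`. -/
def shell : Set (E3 × Bool) := {p | M.σ / M.Λ ≤ ‖p.1‖ ∧ ‖p.1‖ ≤ 1}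

/-- Lebesgue measure in `k`, summed over the polarizations, restricted to the shell. -/
def μ : Measure (E3 × Bool) := ((volume : Measure E3).prod Measure.count).restrict M.shell

/-- The one-photon Hilbert space `L²(shell; ℂ)`. -/
abbrev Photon : Type := Lp ℂ 2 M.μ

theorem measurableSet_shell : MeasurableSet M.shell := by
  have h : Measurable fun p : E3 × Bool => ‖p.1‖ := measurable_fst.norm
  exact (measurableSet_le measurable_const h).inter (measurableSet_le h measurable_const)

theorem cutoff_pos : 0 < M.σ / M.Λ := div_pos M.σ_pos (zero_lt_one.trans_le M.one_le_Λ)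

theorem ae_mem_shell : ∀ᵐ p ∂M.μ, p ∈ M.shell := ae_restrict_mem M.measurableSet_shell

instance : IsFiniteMeasure M.μ := by
  refine ⟨?_⟩
  rw [μ, Measure.restrict_apply MeasurableSet.univ, Set.univ_inter]
  have h : M.shell ⊆ Metric.closedBall (0 : E3) 1 ×ˢ Set.univ := by
    rintro ⟨k, τ⟩ ⟨-, hk⟩
    exact ⟨by simpa using hk, trivial⟩
  refine (measure_mono h).trans_lt ?_
  rw [Measure.prod_prod]
  refine ENNReal.mul_lt_top (isCompact_closedBall _ _).measure_lt_top ?_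
  rw [Measure.count_apply_finite _ Set.finite_univ]
  exact ENNReal.natCast_lt_top _

/-- A measurable function that is bounded on the shell lies in every `Lᵖ` over the shell. -/
theorem memLp_of_bound {m : E3 × Bool → ℝ} (hm : Measurable m) {C : ℝ}
    (hC : ∀ p ∈ M.shell, |m p| ≤ C) (q : ℝ≥0∞) : MemLp (fun p => (m p : ℂ)) q M.μ := by
  refine MemLp.of_bound (Complex.measurable_ofReal.comp hm).aestronglyMeasurable C ?_
  filter_upwards [M.ae_mem_shell] with p hp
  simpa using hC p hp

theorem rpow_bound (s : ℝ) :
    ∀ p ∈ M.shell, |‖p.1‖ ^ s| ≤ max ((M.σ / M.Λ) ^ s) 1 := by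
  rintro p ⟨h1, h2⟩
  have hp : 0 < ‖p.1‖ := M.cutoff_pos.trans_le h1
  rw [abs_of_nonneg (Real.rpow_nonneg hp.le s)]
  rcases le_total 0 s with hs | hs
  · exact (Real.rpow_le_one hp.le h2 hs).trans (le_max_right _ _)
  · exact (Real.rpow_le_rpow_of_nonpos M.cutoff_pos h1 hs).trans (le_max_left _ _)

theorem memLp_rpow (s : ℝ) (q : ℝ≥0∞) :
    MemLp (fun p : E3 × Bool => ((‖p.1‖ ^ s : ℝ) : ℂ)) q M.μ :=
  M.memLp_of_bound (measurable_fst.norm.pow_const s) (M.rpow_bound s) q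

theorem memLp_coord (ν : Fin 3) (q : ℝ≥0∞) :
    MemLp (fun p : E3 × Bool => ((p.1 ν : ℝ) : ℂ)) q M.μ := by
  refine M.memLp_of_bound (C := 1) ?_ ?_ q
  · exact (EuclideanSpace.proj (𝕜 := ℝ) ν).continuous.measurable.comp measurable_fst
  · rintro p ⟨-, h2⟩
    exact (PiLp.norm_apply_le p.1 ν).trans h2

theorem memLp_coupling (ν : Fin 3) (q : ℝ≥0∞) :
    MemLp (fun p : E3 × Bool => ((M.g * ‖p.1‖ ^ (-(1 / 2) : ℝ) * M.pol p.1 p.2 ν : ℝ) : ℂ))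
      q M.μ := by
  refine M.memLp_of_bound (C := M.g * max ((M.σ / M.Λ) ^ (-(1 / 2) : ℝ)) 1 * 1) ?_ ?_ q
  · have h : Measurable fun p : E3 × Bool => M.pol p.1 p.2 :=
      measurable_from_prod_countable_left M.measurable_pol
    exact (measurable_const.mul (measurable_fst.norm.pow_const _)).mul
      ((EuclideanSpace.proj (𝕜 := ℝ) ν).continuous.measurable.comp h)
  · intro p hp
    rw [abs_mul, abs_mul, abs_of_nonneg M.g_nonneg]
    have h1 := M.rpow_bound (-(1 / 2)) p hp
    have h2 : |M.pol p.1 p.2 ν| ≤ 1 :=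
      (PiLp.norm_apply_le (M.pol p.1 p.2) ν).trans (M.norm_pol _ _).le
    have h3 := M.g_nonneg
    gcongr

/-- Multiplication by a bounded function `m`, as a bounded operator on the photon space. -/
def mulOp (m : E3 × Bool → ℂ) (hm : MemLp m ∞ M.μ) : M.Photon →L[ℂ] M.Photon :=
  (ContinuousLinearMap.mul ℂ ℂ).holderL M.μ ∞ 2 2 hm.toLp

/-- The operator `|k|^s` of multiplication by `|k|^s`. -/
def absKPow (s : ℝ) : M.Photon →L[ℂ] M.Photon :=
  M.mulOp (fun p => ((‖p.1‖ ^ s : ℝ) : ℂ)) (M.memLp_rpow s ∞)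

/-- The operator `|k|` of multiplication by `|k|`. -/
def absK : M.Photon →L[ℂ] M.Photon := M.absKPow 1

/-- The operator of multiplication by the coordinate `k_ν`. -/
def coordK (ν : Fin 3) : M.Photon →L[ℂ] M.Photon :=
  M.mulOp (fun p => ((p.1 ν : ℝ) : ℂ)) (M.memLp_coord ν ∞)

/-- The coupling function `G_ν(k,τ) = g |k|^{-1/2} ε_ν(k,τ)`. -/
def coupling (ν : Fin 3) : M.Photon := (M.memLp_coupling ν 2).toLp

/-- The vector `G_ν + k_ν η`. -/
def shifted (η : M.Photon) (ν : Fin 3) : M.Photon := M.coupling ν + M.coordK ν η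

/-- `P_η = 2 ∑_ν |G_ν + k_ν η⟩⟨G_ν + k_ν η|`. -/
def P (η : M.Photon) : M.Photon →L[ℂ] M.Photon :=
  (2 : ℂ) • ∑ ν : Fin 3, InnerProductSpace.rankOne ℂ (M.shifted η ν) (M.shifted η ν)

/-- The operator `|k| z² (1+z)⁻¹`. -/
def kinetic (z : M.Photon →L[ℂ] M.Photon) : M.Photon →L[ℂ] M.Photon :=
  M.absK * z ^ 2 * Ring.inverse (1 + z)

/-- The energy functional
`𝒢(z,η) = (Λ²/2) ∑_ν ⟨G_ν + k_ν η, (1+z)⁻¹ (G_ν + k_ν η)⟩ + (Λ/4) Tr(|k| z² (1+z)⁻¹) + Λ ⟨η, |k| η⟩`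
(all its terms are real). -/
def energy (z : M.Photon →L[ℂ] M.Photon) (η : M.Photon) : ℝ :=
  M.Λ ^ 2 / 2 * ∑ ν : Fin 3, (⟪M.shifted η ν, Ring.inverse (1 + z) (M.shifted η ν)⟫_ℂ).re
    + M.Λ / 4 * (trace (M.kinetic z)).re
    + M.Λ * (⟪η, M.absK η⟫_ℂ).re

/-- The set of values of `𝒢` on `HS_ε × L²`. -/
def energyValues (ε : ℝ) : Set ℝ :=
  {e | ∃ z ∈ HSge M.Photon ε, ∃ η : M.Photon, e = M.energy z η}

/-- The infimum of `𝒢` over `HS_ε × L²`. -/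
def minEnergy (ε : ℝ) : ℝ := sInf (M.energyValues ε)

/-- `z_*(η) = |k|^{-1/2} (|k|^{1/2} (Λ P_η + |k|) |k|^{1/2})^{1/2} |k|^{-1/2} - 1`. -/
def zStar (η : M.Photon) : M.Photon →L[ℂ] M.Photon :=
  M.absKPow (-(1 / 2)) *
      opSqrt (M.absKPow (1 / 2) * ((M.Λ : ℂ) • M.P η + M.absK) * M.absKPow (1 / 2)) *
    M.absKPow (-(1 / 2)) - 1

/-- `2Λ|k| + Λ² ∑_ν k_ν (1+z)⁻¹ k_ν`. -/
def hessian (z : M.Photon →L[ℂ] M.Photon) : M.Photon →L[ℂ] M.Photon :=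
  ((2 * M.Λ : ℝ) : ℂ) • M.absK +
    ((M.Λ ^ 2 : ℝ) : ℂ) • ∑ ν : Fin 3, M.coordK ν * Ring.inverse (1 + z) * M.coordK ν

/-- `η_*(z) = -(2Λ|k| + Λ² ∑_ν k_ν (1+z)⁻¹ k_ν)⁻¹ (Λ² ∑_ν k_ν (1+z)⁻¹ G_ν)`. -/
def etaStar (z : M.Photon →L[ℂ] M.Photon) : M.Photon :=
  -(Ring.inverse (M.hessian z)
    (((M.Λ ^ 2 : ℝ) : ℂ) • ∑ ν : Fin 3, M.coordK ν (Ring.inverse (1 + z) (M.coupling ν))))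

/-- `(Λ |k|^{1/2} P_η |k|^{1/2} + |k|²)^{1/2} - |k|`. -/
def reducedOp (η : M.Photon) : M.Photon →L[ℂ] M.Photon :=
  opSqrt ((M.Λ : ℂ) • (M.absKPow (1 / 2) * M.P η * M.absKPow (1 / 2)) + M.absK ^ 2) - M.absK

end Model

end BHF

end

noncomputable section

namespace BHF

/-! ### Hilbert–Schmidt operators, cyclicity of the trace, coercivity -/

section HilbertSchmidt

variable {H : Type*} [NormedAddCommGroup H] [InnerProductSpace ℂ H] [CompleteSpace H]

/-! Write X = 1 + z, A = |k|^{1/2}, K = A² and L = ΛP_η. Up to the factor Λ/4 and the term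
Λ⟨η,|k|η⟩, the energy is Tr(K(X-1)²X⁻¹) + Tr(LX⁻¹), formally Tr(KX) + Tr((K+L)X⁻¹) - 2 Tr K.
Stationarity in X is the Riccati equation X₀KX₀ = K + L, whose positive solution is 1 + z_*. The
formal traces diverge in general, so nothing is differentiated: `comparison_identity` expands the
energy difference algebraically, up to a commutator of Hilbert–Schmidt operators, whose trace is
zero. By `trace_comparison` the excess energy is a multiple of Tr(A D X⁻¹ D A) with D = z_* - z,
which is positive unless D = 0. Minimality and uniqueness follow together.

The analytic point is that z_* is trace class. The operator R = (ALA + A⁴)^{1/2} - A² is positive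
and solves RS + SR = 2ALA with S = R + 2A². Here S is coercive because the infrared cutoff keeps |k|
away from 0, and L has finite trace, so `finiteTrace_of_lyapunov` applies. Cyclicity then gives the
reduced energy through Tr R (`trace_minimizer`).

For fixed z the energy is a quadratic polynomial in η with coercive Hessian (`energy_add`,
`hessian_coercive`), so completing the square gives η_*. The remaining claims combine the two
partial minimizations. -/

theorem inner_apply_eq_inner_star (S : H →L[ℂ] H) (x y : H) : ⟪x, S y⟫_ℂ = ⟪star S x, y⟫_ℂ := by
  rw [ContinuousLinearMap.star_eq_adjoint, ContinuousLinearMap.adjoint_inner_left]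

theorem inner_apply_eq_of_isSelfAdjoint {S : H →L[ℂ] H} (hS : IsSelfAdjoint S) (x y : H) :
    ⟪x, S y⟫_ℂ = ⟪S x, y⟫_ℂ := by
  rw [inner_apply_eq_inner_star, hS.star_eq]

omit [CompleteSpace H] in
theorem re_inner_nonneg {S : H →L[ℂ] H} (hS : 0 ≤ S) (x : H) : 0 ≤ (⟪x, S x⟫_ℂ).re :=
  ((ContinuousLinearMap.nonneg_iff_isPositive S).1 hS).re_inner_nonneg_right x

theorem nonneg_of_re_inner_nonneg {S : H →L[ℂ] H} (hS : IsSelfAdjoint S)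
    (h : ∀ x, 0 ≤ (⟪x, S x⟫_ℂ).re) : 0 ≤ S := by
  rw [ContinuousLinearMap.nonneg_iff_isPositive, ContinuousLinearMap.isPositive_def']
  refine ⟨hS, fun x => ?_⟩
  rw [ContinuousLinearMap.reApplyInnerSelf_apply, ← inner_apply_eq_of_isSelfAdjoint hS]
  exact h x

/-- Parseval's identity for the fixed orthonormal basis. -/
theorem hasSum_norm_inner_sq (y : H) :
    HasSum (fun i => ‖⟪stdBasis H i, y⟫_ℂ‖ ^ 2) (‖y‖ ^ 2) := by
  have h := Complex.hasSum_re ((stdBasis H).hasSum_inner_mul_inner y y)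
  rw [← RCLike.re_to_complex, inner_self_eq_norm_sq (𝕜 := ℂ)] at h
  refine h.congr_fun fun i => ?_
  rw [← inner_conj_symm y, ← Complex.normSq_eq_conj_mul_self, Complex.ofReal_re,
    Complex.normSq_eq_norm_sq]

theorem isHilbertSchmidt_iff {S : H →L[ℂ] H} :
    IsHilbertSchmidt S ↔ Summable fun i => ‖S (stdBasis H i)‖ ^ 2 := by
  refine summable_congr fun i => ?_
  rw [mul_apply_eq_comp, inner_apply_eq_inner_star, star_star,
    ← RCLike.re_to_complex, inner_self_eq_norm_sq (𝕜 := ℂ)]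

/-- Parseval turns the norm condition into square summability of the matrix, a condition symmetric
under transposition; closure under adjoints and right multiplication rests on it. -/
theorem isHilbertSchmidt_iff_prod {S : H →L[ℂ] H} :
    IsHilbertSchmidt S ↔ Summable fun p : basisSet H × basisSet H =>
      ‖⟪stdBasis H p.2, S (stdBasis H p.1)⟫_ℂ‖ ^ 2 := by
  rw [isHilbertSchmidt_iff, summable_prod_of_nonneg fun _ => sq_nonneg _]
  simp only [(hasSum_norm_inner_sq _).tsum_eq]
  exact ⟨fun h => ⟨fun i => (hasSum_norm_inner_sq _).summable, h⟩, fun h => h.2⟩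

theorem norm_inner_star_apply (S : H →L[ℂ] H) (x y : H) :
    ‖⟪x, star S y⟫_ℂ‖ = ‖⟪y, S x⟫_ℂ‖ := by
  rw [inner_apply_eq_inner_star, star_star, norm_inner_symm]

theorem IsHilbertSchmidt.star {S : H →L[ℂ] H} (hS : IsHilbertSchmidt S) :
    IsHilbertSchmidt (star S) := by
  rw [isHilbertSchmidt_iff_prod] at hS ⊢
  refine (hS.prod_symm).congr fun p => ?_
  simp only [Prod.fst_swap, Prod.snd_swap, norm_inner_star_apply]

theorem IsHilbertSchmidt.tsum_star {S : H →L[ℂ] H} (hS : IsHilbertSchmidt S) :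
    ∑' i, ‖Star.star S (stdBasis H i)‖ ^ 2 = ∑' i, ‖S (stdBasis H i)‖ ^ 2 := by
  have h1 := isHilbertSchmidt_iff_prod.1 hS
  have h2 := isHilbertSchmidt_iff_prod.1 hS.star
  have e1 := h1.tsum_prod
  have e2 := h2.tsum_prod
  simp only [(hasSum_norm_inner_sq _).tsum_eq] at e1 e2
  rw [← e1, ← e2, ← (Equiv.prodComm _ _).tsum_eq]
  exact tsum_congr fun p => by
    simp only [Equiv.prodComm_apply, Prod.fst_swap, Prod.snd_swap, norm_inner_star_apply]

theorem IsHilbertSchmidt.mul_left {S : H →L[ℂ] H} (hS : IsHilbertSchmidt S) (A : H →L[ℂ] H) :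
    IsHilbertSchmidt (A * S) := by
  rw [isHilbertSchmidt_iff] at hS ⊢
  refine (hS.mul_left (‖A‖ ^ 2)).of_nonneg_of_le (fun _ => sq_nonneg _) fun i => ?_
  rw [← mul_pow]
  exact pow_le_pow_left₀ (norm_nonneg _) (A.le_opNorm _) 2

theorem IsHilbertSchmidt.mul_right {S : H →L[ℂ] H} (hS : IsHilbertSchmidt S) (A : H →L[ℂ] H) :
    IsHilbertSchmidt (S * A) := by
  simpa using (hS.star.mul_left (Star.star A)).star

theorem IsHilbertSchmidt.add {S R : H →L[ℂ] H} (hS : IsHilbertSchmidt S)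
    (hR : IsHilbertSchmidt R) : IsHilbertSchmidt (S + R) := by
  rw [isHilbertSchmidt_iff] at hS hR ⊢
  refine ((hS.add hR).mul_left 2).of_nonneg_of_le (fun _ => sq_nonneg _) fun i => ?_
  have h := pow_le_pow_left₀ (norm_nonneg _) (norm_add_le (S (stdBasis H i)) (R (stdBasis H i))) 2
  rw [add_apply]
  nlinarith [sq_nonneg (‖S (stdBasis H i)‖ - ‖R (stdBasis H i)‖)]

theorem IsHilbertSchmidt.neg {S : H →L[ℂ] H} (hS : IsHilbertSchmidt S) :
    IsHilbertSchmidt (-S) := by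
  simpa using hS.mul_left (-1)

theorem IsHilbertSchmidt.sub {S R : H →L[ℂ] H} (hS : IsHilbertSchmidt S)
    (hR : IsHilbertSchmidt R) : IsHilbertSchmidt (S - R) := by
  rw [sub_eq_add_neg]; exact hS.add hR.neg

/-- The series of diagonal matrix elements of `A` converges absolutely. -/
def DiagSummable (A : H →L[ℂ] H) : Prop :=
  Summable fun i => ⟪stdBasis H i, A (stdBasis H i)⟫_ℂ

theorem DiagSummable.sub {A B : H →L[ℂ] H} (hA : DiagSummable A) (hB : DiagSummable B) :
    DiagSummable (A - B) := by
  refine (Summable.sub hA hB).congr fun i => ?_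
  rw [sub_apply, inner_sub_right]

theorem trace_add {A B : H →L[ℂ] H} (hA : DiagSummable A) (hB : DiagSummable B) :
    trace (A + B) = trace A + trace B := by
  rw [trace, trace, trace, ← Summable.tsum_add hA hB]
  exact tsum_congr fun i => by rw [add_apply, inner_add_right]

theorem trace_sub {A B : H →L[ℂ] H} (hA : DiagSummable A) (hB : DiagSummable B) :
    trace (A - B) = trace A - trace B := by
  rw [trace, trace, trace, ← Summable.tsum_sub hA hB]
  exact tsum_congr fun i => by rw [sub_apply, inner_sub_right]

theorem summable_inner_mul_inner_prod {S R : H →L[ℂ] H} (hS : IsHilbertSchmidt S)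
    (hR : IsHilbertSchmidt R) : Summable fun p : basisSet H × basisSet H =>
      ⟪stdBasis H p.1, S (stdBasis H p.2)⟫_ℂ * ⟪stdBasis H p.2, R (stdBasis H p.1)⟫_ℂ := by
  have h1 := (isHilbertSchmidt_iff_prod.1 hS).prod_symm
  have h2 := isHilbertSchmidt_iff_prod.1 hR
  refine Summable.of_norm_bounded (h1.add h2) fun p => ?_
  rw [norm_mul]
  simp only [Prod.fst_swap, Prod.snd_swap]
  nlinarith [sq_nonneg (‖⟪stdBasis H p.1, S (stdBasis H p.2)⟫_ℂ‖ -
    ‖⟪stdBasis H p.2, R (stdBasis H p.1)⟫_ℂ‖),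
    sq_nonneg ‖⟪stdBasis H p.1, S (stdBasis H p.2)⟫_ℂ‖,
    sq_nonneg ‖⟪stdBasis H p.2, R (stdBasis H p.1)⟫_ℂ‖]

theorem tsum_inner_mul_inner_eq (S R : H →L[ℂ] H) (x : H) :
    ∑' j, ⟪x, S (stdBasis H j)⟫_ℂ * ⟪stdBasis H j, R x⟫_ℂ = ⟪x, (S * R) x⟫_ℂ := by
  simp only [inner_apply_eq_inner_star S]
  rw [(stdBasis H).tsum_inner_mul_inner, mul_apply_eq_comp,
    inner_apply_eq_inner_star S]

theorem diagSummable_mul {S R : H →L[ℂ] H} (hS : IsHilbertSchmidt S)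
    (hR : IsHilbertSchmidt R) : DiagSummable (S * R) := by
  refine (summable_inner_mul_inner_prod hS hR).prod.congr fun i => ?_
  exact tsum_inner_mul_inner_eq S R (stdBasis H i)

theorem trace_mul_eq_tsum_prod {S R : H →L[ℂ] H} (hS : IsHilbertSchmidt S)
    (hR : IsHilbertSchmidt R) : trace (S * R) = ∑' p : basisSet H × basisSet H,
      ⟪stdBasis H p.1, S (stdBasis H p.2)⟫_ℂ * ⟪stdBasis H p.2, R (stdBasis H p.1)⟫_ℂ := by
  rw [(summable_inner_mul_inner_prod hS hR).tsum_prod, trace]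
  exact tsum_congr fun i => (tsum_inner_mul_inner_eq S R _).symm

/-- Cyclicity of the trace for products of Hilbert-Schmidt operators. -/
theorem trace_mul_comm {S R : H →L[ℂ] H} (hS : IsHilbertSchmidt S)
    (hR : IsHilbertSchmidt R) : trace (S * R) = trace (R * S) := by
  rw [trace_mul_eq_tsum_prod hS hR, trace_mul_eq_tsum_prod hR hS, ← (Equiv.prodComm _ _).tsum_eq]
  exact tsum_congr fun p => mul_comm _ _

theorem hasSum_rankOne_mul (u v : H) (Y : H →L[ℂ] H) :
    HasSum (fun i => ⟪stdBasis H i, (InnerProductSpace.rankOne ℂ u v * Y) (stdBasis H i)⟫_ℂ)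
      ⟪v, Y u⟫_ℂ := by
  rw [inner_apply_eq_inner_star]
  refine ((stdBasis H).hasSum_inner_mul_inner (star Y v) u).congr_fun fun i => ?_
  rw [mul_apply_eq_comp, InnerProductSpace.rankOne_apply, inner_smul_right,
    inner_apply_eq_inner_star]

theorem IsHilbertSchmidt.of_finiteTrace {R : H →L[ℂ] H} (hR : 0 ≤ R) (h : FiniteTrace R) :
    IsHilbertSchmidt (CFC.sqrt R) := by
  rw [IsHilbertSchmidt, (CFC.sqrt_nonneg R).isSelfAdjoint.star_eq, CFC.sqrt_mul_sqrt_self R hR]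
  exact h

theorem isTraceClass_of_nonneg {R : H →L[ℂ] H} (hR : 0 ≤ R) (h : FiniteTrace R) :
    IsTraceClass R := by
  rwa [IsTraceClass, CFC.abs_of_nonneg R hR]

/-- Lax–Milgram. All the inverses in the proof come from here: of 1 + z, of the Hessian and of the
auxiliary shifted operators. -/
theorem isUnit_of_coercive {S : H →L[ℂ] H} {c : ℝ} (hc : 0 < c)
    (h : ∀ x, c * ‖x‖ ^ 2 ≤ (⟪x, S x⟫_ℂ).re) : IsUnit S := by
  refine S.isUnit_of_forall_le_norm_inner_map (c := ⟨c, hc.le⟩) hc fun x => ?_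
  rw [norm_inner_symm]
  have := Complex.re_le_norm ⟪x, S x⟫_ℂ
  have h2 := h x
  rw [mul_comm]
  exact (h2.trans this)

/-- The cross term 2δ⟨y, Ny⟩ is nonnegative. With N = |W| this makes W(|W| + δ)⁻¹ a contraction. -/
theorem norm_apply_le_norm_add {N : H →L[ℂ] H} (hN : 0 ≤ N) {δ : ℝ} (hδ : 0 < δ) (y : H) :
    ‖N y‖ ≤ ‖(N + (δ : ℂ) • (1 : H →L[ℂ] H)) y‖ := by
  refine le_of_sq_le_sq ?_ (norm_nonneg _)
  have h : ‖N y + (δ : ℂ) • y‖ ^ 2 = _ := norm_add_sq (𝕜 := ℂ) (N y) ((δ : ℂ) • y)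
  have h1 : (⟪N y, y⟫_ℂ).re = (⟪y, N y⟫_ℂ).re := by
    rw [inner_apply_eq_of_isSelfAdjoint hN.isSelfAdjoint]
  have h2 := re_inner_nonneg hN y
  simp only [add_apply, smul_apply,
    one_apply_eq_self]
  rw [h, inner_smul_right, RCLike.re_to_complex, Complex.re_ofReal_mul, h1]
  nlinarith [mul_nonneg hδ.le h2, sq_nonneg ‖(δ : ℂ) • y‖]

theorem norm_cfcAbs_apply (W : H →L[ℂ] H) (y : H) : ‖CFC.abs W y‖ = ‖W y‖ := by
  have h : ∀ V : H →L[ℂ] H, (⟪y, (star V * V) y⟫_ℂ).re = ‖V y‖ ^ 2 := fun V => by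
    rw [mul_apply_eq_comp, inner_apply_eq_inner_star, star_star,
      ← RCLike.re_to_complex, inner_self_eq_norm_sq (𝕜 := ℂ)]
  have h1 := h (CFC.abs W)
  rw [(CFC.abs_nonneg W).isSelfAdjoint.star_eq, CFC.abs_mul_abs, h] at h1
  exact (pow_left_inj₀ (norm_nonneg _) (norm_nonneg _) two_ne_zero).1 h1.symm

end HilbertSchmidt

/-! ### Trace-class criteria: products and the Lyapunov equation -/

section TraceClass

variable {H : Type*} [NormedAddCommGroup H] [InnerProductSpace ℂ H] [CompleteSpace H]

/-- Passing to adjoints moves V to the left, where its operator norm can be pulled out. The bound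
does not depend on F. -/
theorem sum_norm_mul_apply_sq_le {Y : H →L[ℂ] H} (hY : IsHilbertSchmidt Y) (V : H →L[ℂ] H)
    (F : Finset (basisSet H)) :
    ∑ i ∈ F, ‖(Y * V) (stdBasis H i)‖ ^ 2 ≤ ‖V‖ ^ 2 * ∑' i, ‖Y (stdBasis H i)‖ ^ 2 := by
  have h := isHilbertSchmidt_iff.1 (hY.mul_right V)
  have h' := isHilbertSchmidt_iff.1 hY.star
  have h'' := isHilbertSchmidt_iff.1 (hY.mul_right V).star
  refine (h.sum_le_tsum F fun _ _ => sq_nonneg _).trans ?_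
  rw [← (hY.mul_right V).tsum_star, ← hY.tsum_star, ← tsum_mul_left]
  refine h''.tsum_le_tsum (fun i => ?_) (h'.mul_left _)
  rw [star_mul, ← mul_pow, ← norm_star V]
  exact pow_le_pow_left₀ (norm_nonneg _) ((star V).le_opNorm _) 2

/-- The product of two Hilbert-Schmidt operators is trace class. -/
theorem isTraceClass_mul {S R : H →L[ℂ] H} (hS : IsHilbertSchmidt S) (hR : IsHilbertSchmidt R) :
    IsTraceClass (S * R) := by
  set W := S * R with hW
  set N := CFC.abs W with hN
  have hN0 : 0 ≤ N := CFC.abs_nonneg W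
  refine summable_of_sum_le (c := (∑' i, ‖star S (stdBasis H i)‖ ^ 2 +
    ∑' i, ‖R (stdBasis H i)‖ ^ 2)) (fun i => re_inner_nonneg hN0 _) fun F => ?_
  refine le_of_forall_pos_le_add fun δ' hδ' => ?_
  obtain ⟨δ, hδ, hδF⟩ : ∃ δ : ℝ, 0 < δ ∧ F.card * δ ≤ δ' := by
    refine ⟨δ' / (F.card + 1), by positivity, ?_⟩
    rw [mul_div_assoc', div_le_iff₀ (by positivity)]
    nlinarith
  -- Regularized polar decomposition: with J = (|W| + δ)⁻¹ the contraction W J replaces the partial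
  -- isometry of W.
  set D := N + (δ : ℂ) • (1 : H →L[ℂ] H) with hD
  have hDu : IsUnit D := by
    refine isUnit_of_coercive hδ fun x => ?_
    have h := re_inner_nonneg hN0 x
    simp only [hD, add_apply, smul_apply, one_apply_eq_self, inner_add_right, inner_smul_right,
      Complex.add_re, Complex.re_ofReal_mul]
    rw [← RCLike.re_to_complex (x := ⟪x, x⟫_ℂ), inner_self_eq_norm_sq (𝕜 := ℂ)]
    linarith
  set J := Ring.inverse D with hJ
  have hJD : J * D = 1 := Ring.inverse_mul_cancel D hDu
  have hDJ : D * J = 1 := Ring.mul_inverse_cancel D hDu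
  have hDs : star D = D := by
    simp [hD, hN0.isSelfAdjoint.star_eq]
  have hJs : star J = J := by
    have h : star J * D = 1 := by
      have := congrArg star hDJ
      rwa [star_mul, hDs, star_one] at this
    calc star J = star J * (D * J) := by rw [hDJ, mul_one]
      _ = J := by rw [← mul_assoc, h, one_mul]
  have hNJ : ∀ x, ‖N (J x)‖ ≤ ‖x‖ := fun x => by
    refine (norm_apply_le_norm_add hN0 hδ (J x)).trans_eq ?_
    rw [← hD, ← mul_apply_eq_comp, hDJ, one_apply_eq_self]
  have hC : ‖W * J‖ ≤ 1 := by
    refine ContinuousLinearMap.opNorm_le_bound _ zero_le_one fun x => ?_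
    rw [mul_apply_eq_comp, ← norm_cfcAbs_apply, one_mul]
    exact hNJ x
  -- From N = J D N = J N² + δ J N, where N² = W*W and J commutes with N.
  have hkey : N = star (W * J) * W + (δ : ℂ) • (N * J) := by
    have hND : D * N = N * D := by simp [hD, mul_add, add_mul]
    have hc : J * N = N * J := by
      calc J * N = J * (N * D) * J := by rw [mul_assoc, mul_assoc, hDJ, mul_one]
        _ = N * J := by rw [← hND, ← mul_assoc, hJD, one_mul]
    rw [star_mul, hJs, mul_assoc, ← CFC.abs_mul_abs, ← hN, ← hc]
    calc N = J * (D * N) := by rw [← mul_assoc, hJD, one_mul]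
      _ = _ := by simp [hD, add_mul, mul_add]
  -- The first term of the splitting is ⟨S*WJe, Re⟩, bounded by Cauchy–Schwarz and ab ≤ a² + b²; the
  -- second is at most δ because NJ is a contraction.
  have hbd : ∀ i, (⟪stdBasis H i, N (stdBasis H i)⟫_ℂ).re ≤
      ‖(star S * (W * J)) (stdBasis H i)‖ ^ 2 + ‖R (stdBasis H i)‖ ^ 2 + δ := fun i => by
    set e := stdBasis H i
    have he : ‖e‖ = 1 := (stdBasis H).orthonormal.1 i
    conv_lhs => rw [hkey]
    rw [add_apply, inner_add_right, Complex.add_re, smul_apply, inner_smul_right,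
      Complex.re_ofReal_mul, mul_apply_eq_comp, inner_apply_eq_inner_star, star_star,
      hW, mul_apply_eq_comp S R e, inner_apply_eq_inner_star S]
    have h1 := (Complex.re_le_norm _).trans (norm_inner_le_norm (𝕜 := ℂ)
      ((star S) ((S * R * J) e)) (R e))
    have h2 := (Complex.re_le_norm _).trans (norm_inner_le_norm (𝕜 := ℂ) e ((N * J) e))
    have h3 := hNJ e
    rw [mul_apply_eq_comp] at h2
    rw [he, one_mul] at h2
    rw [he] at h3
    simp only [mul_apply_eq_comp] at h1 h2 ⊢
    nlinarith [sq_nonneg (‖(star S) (S (R (J e)))‖ - ‖R e‖), sq_nonneg ‖(star S) (S (R (J e)))‖,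
      sq_nonneg ‖R e‖]
  refine (Finset.sum_le_sum fun i _ => hbd i).trans ?_
  rw [Finset.sum_add_distrib, Finset.sum_add_distrib, Finset.sum_const, nsmul_eq_mul]
  have h1 := sum_norm_mul_apply_sq_le hS.star (W * J) F
  have h2 := (isHilbertSchmidt_iff.1 hR).sum_le_tsum F fun _ _ => sq_nonneg _
  have h3 : ‖W * J‖ ^ 2 * ∑' i, ‖star S (stdBasis H i)‖ ^ 2 ≤ ∑' i, ‖star S (stdBasis H i)‖ ^ 2 :=
    mul_le_of_le_one_left (tsum_nonneg fun _ => sq_nonneg _) (pow_le_one₀ (norm_nonneg _) hC)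
  linarith

/-- The two squared norms differ by 4⟨x, Sx⟩. This makes the Cayley transform (S-1)(S+1)⁻¹ a strict
contraction. -/
theorem norm_apply_sub_sq_le {S : H →L[ℂ] H} (hS : IsSelfAdjoint S) {c : ℝ}
    (h : ∀ x, c * ‖x‖ ^ 2 ≤ (⟪x, S x⟫_ℂ).re) (x : H) :
    ‖(S - 1) x‖ ^ 2 + 4 * c * ‖x‖ ^ 2 ≤ ‖(S + 1) x‖ ^ 2 := by
  have h1 : ‖S x + x‖ ^ 2 = _ := norm_add_sq (𝕜 := ℂ) (S x) x
  have h2 : ‖S x - x‖ ^ 2 = _ := norm_sub_sq (𝕜 := ℂ) (S x) x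
  have h3 := h x
  rw [inner_apply_eq_of_isSelfAdjoint hS] at h3
  simp only [add_apply, sub_apply, one_apply_eq_self]
  rw [h1, h2, RCLike.re_to_complex]
  linarith

/-- A positive solution `R` of the Lyapunov equation `R S + S R = Y* Y` with `S` coercive and `Y`
Hilbert-Schmidt has finite trace. -/
theorem finiteTrace_of_lyapunov {R S Y : H →L[ℂ] H} (hR : 0 ≤ R) (hS : IsSelfAdjoint S)
    {c : ℝ} (hc : 0 < c) (hcoer : ∀ x, c * ‖x‖ ^ 2 ≤ (⟪x, S x⟫_ℂ).re)
    (hY : IsHilbertSchmidt Y) (heq : R * S + S * R = star Y * Y) : FiniteTrace R := by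
  have hu : IsUnit (S + 1) := by
    refine isUnit_of_coercive hc fun x => ?_
    rw [add_apply, one_apply_eq_self, inner_add_right, Complex.add_re,
      ← RCLike.re_to_complex (x := ⟪x, x⟫_ℂ), inner_self_eq_norm_sq (𝕜 := ℂ)]
    have := hcoer x
    nlinarith [sq_nonneg ‖x‖]
  set J := Ring.inverse (S + 1) with hJ
  have hJD : J * (S + 1) = 1 := Ring.inverse_mul_cancel _ hu
  have hDJ : (S + 1) * J = 1 := Ring.mul_inverse_cancel _ hu
  have hDs : star (S + 1) = S + 1 := by rw [star_add, hS.star_eq, star_one]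
  have hJs : star J * (S + 1) = 1 := by
    have := congrArg star hDJ
    rwa [star_mul, hDs, star_one] at this
  set C := (S - 1) * J with hC
  have hCs : star C = star J * (S - 1) := by rw [hC, star_mul, star_sub, hS.star_eq, star_one]
  -- Since (S+1)R(S+1) - (S-1)R(S-1) = 2(RS + SR), the Cayley transform turns the Lyapunov equation
  -- into a fixed point equation that can be iterated.
  have hRC : R = star C * R * C + (2 : ℂ) • (star (Y * J) * (Y * J)) := by
    have h1 : (S + 1) * R * (S + 1) = (S - 1) * R * (S - 1) + (2 : ℂ) • (star Y * Y) := by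
      rw [← heq, two_smul]; noncomm_ring
    calc R = star J * (S + 1) * R * ((S + 1) * J) := by rw [hJs, hDJ, one_mul, mul_one]
      _ = star J * ((S + 1) * R * (S + 1)) * J := by simp only [mul_assoc]
      _ = _ := by
        rw [h1, hCs, hC, star_mul]
        simp only [mul_assoc, mul_add, add_mul, mul_smul_comm, smul_mul_assoc]
  set ρ := ‖C‖ ^ 2 with hρ
  have hρ1 : ρ < 1 := by
    -- The summand 4c ensures m > 0 and 4c/m ≤ 1, so that the square root below is of a nonnegative
    -- number.
    set m := ‖S + 1‖ ^ 2 + 4 * c with hm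
    have hm0 : 0 < m := by positivity
    have hq : 0 ≤ 1 - 4 * c / m := by
      rw [sub_nonneg, div_le_one hm0, hm]; nlinarith [sq_nonneg ‖S + 1‖]
    have hle : ‖C‖ ≤ Real.sqrt (1 - 4 * c / m) := by
      refine ContinuousLinearMap.opNorm_le_bound _ (Real.sqrt_nonneg _) fun x => ?_
      refine le_of_sq_le_sq ?_ (by positivity)
      rw [mul_pow, Real.sq_sqrt hq]
      have h1 := norm_apply_sub_sq_le hS hcoer (J x)
      rw [← mul_apply_eq_comp (S + 1), hDJ, one_apply_eq_self, ← mul_apply_eq_comp (S - 1), ← hC]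
        at h1
      have h2 : ‖x‖ ^ 2 ≤ m * ‖J x‖ ^ 2 := by
        have h3 := (S + 1).le_opNorm (J x)
        rw [← mul_apply_eq_comp (S + 1), hDJ, one_apply_eq_self] at h3
        have h4 := pow_le_pow_left₀ (norm_nonneg _) h3 2
        nlinarith [sq_nonneg ‖J x‖, mul_nonneg hc.le (sq_nonneg ‖J x‖)]
      have h5 : 4 * c / m * ‖x‖ ^ 2 ≤ 4 * c * ‖J x‖ ^ 2 := by
        rw [div_mul_eq_mul_div, div_le_iff₀ hm0]
        nlinarith
      linarith
    calc ρ ≤ Real.sqrt (1 - 4 * c / m) ^ 2 := pow_le_pow_left₀ (norm_nonneg _) hle 2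
      _ = 1 - 4 * c / m := Real.sq_sqrt hq
      _ < 1 := by have : 0 < 4 * c / m := by positivity
                  linarith
  have hρ0 : 0 ≤ ρ := sq_nonneg _
  set t := 2 * (‖J‖ ^ 2 * ∑' i, ‖Y (stdBasis H i)‖ ^ 2) with ht
  have ht0 : 0 ≤ t :=
    mul_nonneg zero_le_two (mul_nonneg (sq_nonneg _) (tsum_nonneg fun _ => sq_nonneg _))
  refine summable_of_sum_le (c := t / (1 - ρ)) (fun i => re_inner_nonneg hR _) fun F => ?_
  -- A partial sum of Tr(V*RV). General V is needed: a sum over the fixed finite set F for V = C is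
  -- not controlled by the one for V = 1, so the iteration replaces V by CV.
  let τ : (H →L[ℂ] H) → ℝ := fun V =>
    ∑ i ∈ F, (⟪V (stdBasis H i), R (V (stdBasis H i))⟫_ℂ).re
  have hstep : ∀ V, τ V ≤ τ (C * V) + t * ‖V‖ ^ 2 := fun V => by
    have h1 : τ V = τ (C * V) + 2 * ∑ i ∈ F, ‖(Y * (J * V)) (stdBasis H i)‖ ^ 2 := by
      simp only [τ]
      rw [Finset.mul_sum, ← Finset.sum_add_distrib]
      refine Finset.sum_congr rfl fun i _ => ?_
      set y := V (stdBasis H i) with hy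
      conv_lhs => rw [hRC]
      rw [add_apply, smul_apply, inner_add_right, inner_smul_right, Complex.add_re]
      simp only [mul_apply_eq_comp, ← hy]
      rw [inner_apply_eq_inner_star (star C), star_star, inner_apply_eq_inner_star (star (Y * J)),
        star_star, mul_apply_eq_comp Y J, show (2 : ℂ) = ((2 : ℝ) : ℂ) by norm_num,
        Complex.re_ofReal_mul, ← RCLike.re_to_complex
        (x := ⟪Y (J y), _⟫_ℂ), inner_self_eq_norm_sq (𝕜 := ℂ)]
    have h2 := sum_norm_mul_apply_sq_le hY (J * V) F
    have h3 : ‖J * V‖ ^ 2 ≤ ‖J‖ ^ 2 * ‖V‖ ^ 2 := by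
      rw [← mul_pow]; exact pow_le_pow_left₀ (norm_nonneg _) (norm_mul_le _ _) 2
    have h0 : 0 ≤ ∑' i, ‖Y (stdBasis H i)‖ ^ 2 := tsum_nonneg fun i => sq_nonneg _
    have h4 := mul_le_mul_of_nonneg_right h3 h0
    rw [h1, ht]
    linarith
  have hbase : ∀ V, τ V ≤ F.card * ‖R‖ * ‖V‖ ^ 2 := fun V => by
    rw [mul_assoc, ← nsmul_eq_mul]
    refine Finset.sum_le_card_nsmul _ _ _ fun i _ => ?_
    have he : ‖stdBasis H i‖ = 1 := (stdBasis H).orthonormal.1 i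
    have h1 := V.le_opNorm (stdBasis H i)
    rw [he, mul_one] at h1
    refine (Complex.re_le_norm _).trans ((norm_inner_le_norm _ _).trans ?_)
    calc _ ≤ ‖V (stdBasis H i)‖ * (‖R‖ * ‖V (stdBasis H i)‖) := by
          gcongr; exact R.le_opNorm _
      _ ≤ ‖V‖ * (‖R‖ * ‖V‖) := by gcongr
      _ = _ := by ring
  have hτ1 : τ 1 = ∑ i ∈ F, (⟪stdBasis H i, R (stdBasis H i)⟫_ℂ).re := rfl
  rw [← hτ1]
  clear_value ρ t τ
  have hFR : 0 ≤ F.card * ‖R‖ := mul_nonneg (Nat.cast_nonneg _) (norm_nonneg _)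
  -- The crude bound, which depends on F, is damped by ρⁿ; the F-independent t/(1-ρ) is the fixed
  -- point of s ↦ ρs + t.
  have hind : ∀ n : ℕ, ∀ V, τ V ≤ (ρ ^ n * (F.card * ‖R‖) + t / (1 - ρ)) * ‖V‖ ^ 2 := by
    have h1ρ : 0 < 1 - ρ := sub_pos.2 hρ1
    intro n
    induction n with
    | zero =>
      intro V
      have := hbase V
      have h2 : 0 ≤ t / (1 - ρ) * ‖V‖ ^ 2 := by positivity
      rw [pow_zero, one_mul, add_mul]
      linarith
    | succ n ih =>
      intro V
      have h1 := hstep V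
      have h2 := ih (C * V)
      have h3 : ‖C * V‖ ^ 2 ≤ ρ * ‖V‖ ^ 2 := by
        rw [hρ, ← mul_pow]; exact pow_le_pow_left₀ (norm_nonneg _) (norm_mul_le _ _) 2
      have h4 : 0 ≤ ρ ^ n * (F.card * ‖R‖) + t / (1 - ρ) :=
        add_nonneg (mul_nonneg (pow_nonneg hρ0 n) hFR) (div_nonneg ht0 h1ρ.le)
      have h5 := mul_le_mul_of_nonneg_left h3 h4
      have h6 : t / (1 - ρ) = t / (1 - ρ) * ρ + t := by field_simp; ring
      calc τ V ≤ (ρ ^ n * (F.card * ‖R‖) + t / (1 - ρ)) * (ρ * ‖V‖ ^ 2) + t * ‖V‖ ^ 2 := by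
            linarith
        _ = (ρ ^ (n + 1) * (F.card * ‖R‖) + (t / (1 - ρ) * ρ + t)) * ‖V‖ ^ 2 := by ring
        _ = _ := by rw [← h6]
  have hlim : Filter.Tendsto (fun n : ℕ => ρ ^ n * (F.card * ‖R‖) + t / (1 - ρ)) Filter.atTop
      (nhds (0 * (F.card * ‖R‖) + t / (1 - ρ))) :=
    ((tendsto_pow_atTop_nhds_zero_of_lt_one hρ0 hρ1).mul_const _).add_const _
  rw [zero_mul, zero_add] at hlim
  refine ge_of_tendsto' hlim fun n => (hind n 1).trans ?_
  have h4 : 0 ≤ ρ ^ n * (F.card * ‖R‖) + t / (1 - ρ) :=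
    add_nonneg (mul_nonneg (pow_nonneg hρ0 n) hFR) (div_nonneg ht0 (sub_pos.2 hρ1).le)
  refine mul_le_of_le_one_right h4 (pow_le_one₀ (norm_nonneg _) ?_)
  exact ContinuousLinearMap.norm_id_le

end TraceClass

/-! ### Exact comparison of energies -/

section Comparison

variable {H : Type*} [NormedAddCommGroup H] [InnerProductSpace ℂ H] [CompleteSpace H]

/-- The terms are grouped so that, once X - 1 and X₀ - 1 are Hilbert–Schmidt, each product on the
right has two Hilbert–Schmidt factors and the final bracket is a commutator of trace zero. -/
theorem comparison_identity {R : Type*} [Ring R] (K : R) {X Y X₀ Y₀ : R} (h1 : X * Y = 1)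
    (h2 : Y * X = 1) (h3 : X₀ * Y₀ = 1) (h4 : Y₀ * X₀ = 1) :
    K * (X - 1) ^ 2 * Y - K * (X₀ - 1) ^ 2 * Y₀ + (X₀ * K * X₀ - K) * (Y - Y₀) =
      X₀ * (K * (X₀ - X) * Y) * ((X₀ - X) * Y₀) +
        ((X₀ - 1) * (K * (X₀ - X) * Y₀) - K * (X₀ - X) * Y₀ * (X₀ - 1)) := by
  have h2' : ∀ Z, Y * (X * Z) = Z := fun Z => by rw [← mul_assoc, h2, one_mul]
  simp only [pow_two, mul_sub, sub_mul, mul_one, one_mul, mul_assoc, h1, h2', h3, h4]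
  abel

/-- At a solution of the Riccati equation the left side is the energy operator, and the right side
no longer contains an inverse. -/
theorem minimizer_identity {R : Type*} [Ring R] (K : R) {X₀ Y₀ : R} (h3 : X₀ * Y₀ = 1) :
    K * (X₀ - 1) ^ 2 * Y₀ + (X₀ * K * X₀ - K) * Y₀ = (X₀ - 1) * K + K * (X₀ - 1) := by
  simp only [pow_two, mul_sub, sub_mul, mul_one, one_mul, mul_assoc, h3]
  abel

theorem diagSummable_kinetic {z : H →L[ℂ] H} (hz : IsHilbertSchmidt z) (K Y : H →L[ℂ] H) :
    DiagSummable (K * z ^ 2 * Y) := by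
  have h := diagSummable_mul (hz.mul_left K) (hz.mul_right Y)
  rwa [show K * z * (z * Y) = K * z ^ 2 * Y by noncomm_ring] at h

theorem isTraceClass_kinetic {z : H →L[ℂ] H} (hz : IsHilbertSchmidt z) (K Y : H →L[ℂ] H) :
    IsTraceClass (K * z ^ 2 * Y) := by
  have h := isTraceClass_mul (hz.mul_left K) (hz.mul_right Y)
  rwa [show K * z * (z * Y) = K * z ^ 2 * Y by noncomm_ring] at h

/-- The exact difference of the energies of `z` and of `z₀`, where `1 + z₀` solves the
Euler-Lagrange equation `(1 + z₀) K (1 + z₀) = L + K` with `K = A²`. -/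
theorem trace_comparison {A L z z₀ Y Y₀ : H →L[ℂ] H} (hz : IsHilbertSchmidt z)
    (hz₀ : IsHilbertSchmidt z₀) (h1 : (1 + z) * Y = 1) (h2 : Y * (1 + z) = 1)
    (h3 : (1 + z₀) * Y₀ = 1) (h4 : Y₀ * (1 + z₀) = 1)
    (hL : (1 + z₀) * (A * A) * (1 + z₀) = L + A * A)
    (hLY : DiagSummable (L * Y)) (hLY₀ : DiagSummable (L * Y₀)) :
    trace (A * A * z ^ 2 * Y) + trace (L * Y) =
      trace (A * A * z₀ ^ 2 * Y₀) + trace (L * Y₀) +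
        trace (A * (z₀ - z) * Y * ((z₀ - z) * A)) := by
  set K := A * A with hK
  set D := z₀ - z with hD
  have hDHS : IsHilbertSchmidt D := hz₀.sub hz
  have hid := comparison_identity K h1 h2 h3 h4
  rw [hL, add_sub_cancel_right, add_sub_cancel_left, add_sub_cancel_left,
    add_sub_add_left_eq_sub, ← hD, mul_sub L] at hid
  have hkz := diagSummable_kinetic hz K Y
  have hkz₀ := diagSummable_kinetic hz₀ K Y₀
  have hM : IsHilbertSchmidt (K * D * Y₀) := (hDHS.mul_left K).mul_right Y₀
  have hS : IsHilbertSchmidt ((1 + z₀) * (K * D * Y)) :=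
    ((hDHS.mul_left K).mul_right Y).mul_left _
  have hS' : IsHilbertSchmidt (D * Y₀) := hDHS.mul_right Y₀
  have hid' := congrArg trace hid
  rw [trace_add (hkz.sub hkz₀) (hLY.sub hLY₀), trace_sub hkz hkz₀, trace_sub hLY hLY₀,
    trace_add (diagSummable_mul hS hS')
      ((diagSummable_mul hz₀ hM).sub (diagSummable_mul hM hz₀)),
    trace_sub (diagSummable_mul hz₀ hM) (diagSummable_mul hM hz₀), trace_mul_comm hz₀ hM, sub_self,
    add_zero, trace_mul_comm hS hS'] at hid'
  -- After cyclic rotation Y₀ meets 1 + z₀ and cancels; a second rotation makes the expression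
  -- symmetric around Y.
  have e : D * Y₀ * ((1 + z₀) * (K * D * Y)) = D * A * (A * D * Y) := by
    calc D * Y₀ * ((1 + z₀) * (K * D * Y)) = D * (Y₀ * (1 + z₀)) * (K * D * Y) := by
          simp only [mul_assoc]
      _ = _ := by rw [h4, mul_one, hK]; simp only [mul_assoc]
  rw [e, trace_mul_comm (hDHS.mul_right A) ((hDHS.mul_left A).mul_right Y)] at hid'
  linear_combination hid'

theorem eq_zero_of_apply_stdBasis {V : H →L[ℂ] H} (h : ∀ i, V (stdBasis H i) = 0) : V = 0 := by
  rw [← star_eq_zero]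
  ext x
  have h1 := hasSum_norm_inner_sq (star V x)
  simp only [inner_apply_eq_inner_star (star V), star_star, h, inner_zero_left, norm_zero] at h1
  have h2 : ‖star V x‖ ^ 2 = 0 :=
    h1.unique (by simp)
  simpa using h2

theorem re_trace_conj {A D Y : H →L[ℂ] H} (hA : IsSelfAdjoint A) (hD : IsSelfAdjoint D)
    (hDHS : IsHilbertSchmidt D) :
    HasSum (fun i => (⟪D (A (stdBasis H i)), Y (D (A (stdBasis H i)))⟫_ℂ).re)
      (trace (A * D * Y * (D * A))).re := by
  have h := Summable.hasSum (diagSummable_mul ((hDHS.mul_left A).mul_right Y) (hDHS.mul_right A))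
  refine (Complex.hasSum_re h).congr_fun fun i => ?_
  simp only [mul_apply_eq_comp]
  rw [inner_apply_eq_of_isSelfAdjoint hA, inner_apply_eq_of_isSelfAdjoint hD]

/-- The trace is the sum of ⟨DAe, YDAe⟩ over the basis. If every DAe vanished, invertibility of A
would force D = 0. Uniqueness of the minimizer in z rests on this strictness. -/
theorem re_trace_conj_pos {A B D Y : H →L[ℂ] H} (hA : IsSelfAdjoint A) (hAB : A * B = 1)
    (hD : IsSelfAdjoint D) (hDHS : IsHilbertSchmidt D) (hD0 : D ≠ 0)
    (hY : ∀ x, x ≠ 0 → 0 < (⟪x, Y x⟫_ℂ).re) : 0 < (trace (A * D * Y * (D * A))).re := by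
  have h := re_trace_conj (Y := Y) hA hD hDHS
  have hnn : ∀ x, 0 ≤ (⟪x, Y x⟫_ℂ).re := fun x => by
    rcases eq_or_ne x 0 with rfl | hx
    · simp
    · exact (hY x hx).le
  obtain ⟨i, hi⟩ : ∃ i, D (A (stdBasis H i)) ≠ 0 := by
    by_contra! hcon
    have h0 : D * A = 0 := eq_zero_of_apply_stdBasis hcon
    exact hD0 (by rw [← mul_one D, ← hAB, ← mul_assoc, h0, zero_mul])
  rw [← h.tsum_eq]
  exact h.summable.tsum_pos (fun i => hnn _) i (hY _ hi)

omit [CompleteSpace H] in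
-- Substituting x = Xy reduces the form of the inverse to that of X.
theorem re_inner_inverse_pos {X Y : H →L[ℂ] H} {c : ℝ} (hc : 0 < c)
    (hX : ∀ x, c * ‖x‖ ^ 2 ≤ (⟪x, X x⟫_ℂ).re) (h1 : X * Y = 1) (x : H) (hx : x ≠ 0) :
    0 < (⟪x, Y x⟫_ℂ).re := by
  have h2 : X (Y x) = x := by rw [← mul_apply_eq_comp, h1, one_apply_eq_self]
  have hy : Y x ≠ 0 := fun h => hx (by rw [← h2, h, map_zero])
  have h3 := hX (Y x)
  rw [h2, ← inner_conj_symm, Complex.conj_re] at h3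
  exact lt_of_lt_of_le (mul_pos hc (pow_pos (norm_pos_iff.2 hy) 2)) h3

theorem re_inner_add_add {S : H →L[ℂ] H} (hS : IsSelfAdjoint S) (s t : H) :
    (⟪s + t, S (s + t)⟫_ℂ).re =
      (⟪s, S s⟫_ℂ).re + 2 * (⟪t, S s⟫_ℂ).re + (⟪t, S t⟫_ℂ).re := by
  have h : (⟪s, S t⟫_ℂ).re = (⟪t, S s⟫_ℂ).re := by
    rw [inner_apply_eq_of_isSelfAdjoint hS, ← inner_conj_symm, Complex.conj_re]
  rw [map_add, inner_add_left, inner_add_right, inner_add_right]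
  simp only [Complex.add_re]
  rw [h]
  ring

theorem isSelfAdjoint_inverse {X : H →L[ℂ] H} (hX : IsSelfAdjoint X)
    (hu : IsUnit X) : IsSelfAdjoint (Ring.inverse X) := by
  have h1 := congrArg star (Ring.mul_inverse_cancel _ hu)
  rw [star_mul, hX.star_eq, star_one] at h1
  calc star (Ring.inverse X) = star (Ring.inverse X) * (X * Ring.inverse X) := by
        rw [Ring.mul_inverse_cancel _ hu, mul_one]
    _ = Ring.inverse X := by rw [← mul_assoc, h1, one_mul]

theorem HSge.coercive {ε : ℝ} {z : H →L[ℂ] H} (hz : z ∈ HSge H ε) (x : H) :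
    (1 - ε) * ‖x‖ ^ 2 ≤ (⟪x, (1 + z) x⟫_ℂ).re := by
  have h := ((ContinuousLinearMap.le_def _ _).1 hz.2.2).re_inner_nonneg_right x
  simp only [sub_neg_eq_add, add_apply, smul_apply, one_apply_eq_self, inner_add_right,
    inner_smul_right, RCLike.re_to_complex, Complex.add_re, Complex.re_ofReal_mul] at h ⊢
  rw [← RCLike.re_to_complex (x := ⟪x, x⟫_ℂ), inner_self_eq_norm_sq (𝕜 := ℂ)] at h ⊢
  linarith

theorem mem_HSge_of_nonneg {ε : ℝ} (hε : 0 ≤ ε) {z : H →L[ℂ] H} (hz : IsHilbertSchmidt z)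
    (h : 0 ≤ z) : z ∈ HSge H ε := by
  refine ⟨hz, h.isSelfAdjoint, le_trans ?_ h⟩
  rw [neg_nonpos]
  refine nonneg_of_re_inner_nonneg (by simp [IsSelfAdjoint]) fun x => ?_
  rw [smul_apply, one_apply_eq_self, inner_smul_right, Complex.re_ofReal_mul,
    ← RCLike.re_to_complex, inner_self_eq_norm_sq (𝕜 := ℂ)]
  positivity

end Comparison

/-! ### The Riccati equation and its solution -/

section Minimizer

variable {H : Type*} [NormedAddCommGroup H] [InnerProductSpace ℂ H] [CompleteSpace H]
  {A B L : H →L[ℂ] H}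

theorem conj_nonneg (hA : IsSelfAdjoint A) (hL : 0 ≤ L) : 0 ≤ A * L * A := by
  refine nonneg_of_re_inner_nonneg ?_ fun x => ?_
  · rw [IsSelfAdjoint, star_mul, star_mul, hA.star_eq, hL.isSelfAdjoint.star_eq, mul_assoc]
  · rw [mul_apply_eq_comp, mul_apply_eq_comp, inner_apply_eq_of_isSelfAdjoint hA]
    exact re_inner_nonneg hL _

theorem isSelfAdjoint_mul_self_nonneg (hA : IsSelfAdjoint A) : 0 ≤ A * A := by
  simpa using conj_nonneg hA zero_le_one

/-- The operator `(A L A + A⁴)^{1/2} - A²`. -/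
def sqrtDiff (A L : H →L[ℂ] H) : H →L[ℂ] H :=
  CFC.sqrt (A * (L + A * A) * A) - A * A

/-- Operator monotonicity of the square root, applied to A⁴ ≤ ALA + A⁴. -/
theorem sqrtDiff_nonneg (hA : IsSelfAdjoint A) (hL : 0 ≤ L) : 0 ≤ sqrtDiff A L := by
  have h : A * A * (A * A) ≤ A * (L + A * A) * A := by
    rw [← sub_nonneg, show A * (L + A * A) * A - A * A * (A * A) = A * L * A by noncomm_ring]
    exact conj_nonneg hA hL
  have h2 := CFC.sqrt_le_sqrt _ _ h
  rw [CFC.sqrt_mul_self _ (isSelfAdjoint_mul_self_nonneg hA)] at h2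
  exact sub_nonneg.2 h2

theorem sqrtDiff_add_mul_self (hA : IsSelfAdjoint A) (hL : 0 ≤ L) :
    (sqrtDiff A L + A * A) * (sqrtDiff A L + A * A) = A * (L + A * A) * A := by
  rw [sqrtDiff, sub_add_cancel]
  exact CFC.sqrt_mul_sqrt_self _ (conj_nonneg hA (add_nonneg hL (isSelfAdjoint_mul_self_nonneg hA)))

theorem coercive_mul_self (hA : IsSelfAdjoint A) (hBA : B * A = 1) (x : H) :
    -- The added 1 keeps the denominator positive even on the zero space, where B = 0.
    1 / (‖B‖ ^ 2 + 1) * ‖x‖ ^ 2 ≤ (⟪x, (A * A) x⟫_ℂ).re := by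
  rw [mul_apply_eq_comp, inner_apply_eq_of_isSelfAdjoint hA, ← RCLike.re_to_complex,
    inner_self_eq_norm_sq (𝕜 := ℂ), one_div, inv_mul_le_iff₀ (by positivity)]
  have h := B.le_opNorm (A x)
  rw [← mul_apply_eq_comp B, hBA, one_apply_eq_self] at h
  have h2 := pow_le_pow_left₀ (norm_nonneg _) h 2
  nlinarith [sq_nonneg ‖A x‖]

/-- Squaring R + A² gives RS + SR = 2ALA with S = R + 2A², a Lyapunov equation whose right side is
Y*Y for Y = (2L)^{1/2}A. -/
theorem finiteTrace_sqrtDiff (hA : IsSelfAdjoint A) (hBA : B * A = 1) (hL : 0 ≤ L)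
    (hLt : FiniteTrace L) : FiniteTrace (sqrtDiff A L) := by
  set R := sqrtDiff A L with hR
  have hR0 : 0 ≤ R := sqrtDiff_nonneg hA hL
  have hK0 : 0 ≤ A * A := isSelfAdjoint_mul_self_nonneg hA
  have hLL : 0 ≤ L + L := add_nonneg hL hL
  have hLLt : FiniteTrace (L + L) := by
    refine (Summable.add hLt hLt).congr fun i => ?_
    rw [add_apply, inner_add_right, Complex.add_re]
  have hY := (IsHilbertSchmidt.of_finiteTrace hLL hLLt).mul_right A
  refine finiteTrace_of_lyapunov (S := R + A * A + A * A) hR0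
    ((hR0.isSelfAdjoint.add hK0.isSelfAdjoint).add hK0.isSelfAdjoint)
    (c := 1 / (‖B‖ ^ 2 + 1)) (by positivity) (fun x => ?_) hY ?_
  · have h1 := coercive_mul_self hA hBA x
    have h2 := re_inner_nonneg hR0 x
    have h3 := re_inner_nonneg hK0 x
    rw [add_apply, add_apply, inner_add_right, inner_add_right, Complex.add_re, Complex.add_re]
    linarith
  · have h := sqrtDiff_add_mul_self hA hL
    rw [← hR] at h
    rw [star_mul, hA.star_eq, (CFC.sqrt_nonneg (L + L)).isSelfAdjoint.star_eq,
      mul_assoc A, ← mul_assoc (CFC.sqrt _) (CFC.sqrt _), CFC.sqrt_mul_sqrt_self _ hLL]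
    calc R * (R + A * A + A * A) + (R + A * A + A * A) * R
        = (R + A * A) * (R + A * A) + (R + A * A) * (R + A * A)
          - (A * (A * A) * A + A * (A * A) * A) := by noncomm_ring
      _ = A * ((L + L) * A) := by rw [h]; noncomm_ring

/-- For `B` the inverse of `A`: `B (A L A + A⁴)^{1/2} B - 1 = B ((A L A + A⁴)^{1/2} - A²) B`. -/
theorem minimizer_eq_conj (hAB : A * B = 1) (hBA : B * A = 1) :
    B * CFC.sqrt (A * (L + A * A) * A) * B - 1 = B * sqrtDiff A L * B := by
  have : B * (A * A) * B = 1 := by rw [← mul_assoc, hBA, one_mul, hAB]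
  rw [sqrtDiff, mul_sub, sub_mul, this]

theorem conj_sqrtDiff_eq (hB : IsSelfAdjoint B) (hA : IsSelfAdjoint A) (hL : 0 ≤ L) :
    B * sqrtDiff A L * B =
      star (CFC.sqrt (sqrtDiff A L) * B) * (CFC.sqrt (sqrtDiff A L) * B) := by
  rw [star_mul, hB.star_eq, (CFC.sqrt_nonneg _).isSelfAdjoint.star_eq, mul_assoc B,
    mul_assoc B, ← mul_assoc (CFC.sqrt _) (CFC.sqrt _),
    CFC.sqrt_mul_sqrt_self _ (sqrtDiff_nonneg hA hL)]

theorem isHilbertSchmidt_sqrt_sqrtDiff (hA : IsSelfAdjoint A) (hBA : B * A = 1) (hL : 0 ≤ L)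
    (hLt : FiniteTrace L) : IsHilbertSchmidt (CFC.sqrt (sqrtDiff A L)) :=
  IsHilbertSchmidt.of_finiteTrace (sqrtDiff_nonneg hA hL) (finiteTrace_sqrtDiff hA hBA hL hLt)

theorem re_trace_sqrtDiff_nonneg (hA : IsSelfAdjoint A) (hBA : B * A = 1) (hL : 0 ≤ L)
    (hLt : FiniteTrace L) : 0 ≤ (trace (sqrtDiff A L)).re := by
  have hR := sqrtDiff_nonneg hA hL
  have hQ := isHilbertSchmidt_sqrt_sqrtDiff hA hBA hL hLt
  have hd := diagSummable_mul hQ hQ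
  rw [CFC.sqrt_mul_sqrt_self _ hR] at hd
  exact (Complex.hasSum_re (Summable.hasSum hd)).nonneg fun i => re_inner_nonneg hR _

theorem finiteTrace_conj_sqrtDiff (hA : IsSelfAdjoint A) (hB : IsSelfAdjoint B) (hBA : B * A = 1)
    (hL : 0 ≤ L) (hLt : FiniteTrace L) : FiniteTrace (B * sqrtDiff A L * B) := by
  rw [conj_sqrtDiff_eq hB hA hL]
  exact (isHilbertSchmidt_sqrt_sqrtDiff hA hBA hL hLt).mul_right B

theorem isHilbertSchmidt_conj_sqrtDiff (hA : IsSelfAdjoint A) (hB : IsSelfAdjoint B)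
    (hBA : B * A = 1) (hL : 0 ≤ L) (hLt : FiniteTrace L) :
    IsHilbertSchmidt (B * sqrtDiff A L * B) := by
  rw [conj_sqrtDiff_eq hB hA hL]
  exact ((isHilbertSchmidt_sqrt_sqrtDiff hA hBA hL hLt).mul_right B).mul_left _

theorem euler_lagrange (hA : IsSelfAdjoint A) (hAB : A * B = 1) (hBA : B * A = 1) (hL : 0 ≤ L) :
    (1 + B * sqrtDiff A L * B) * (A * A) * (1 + B * sqrtDiff A L * B) = L + A * A := by
  have h1 : 1 + B * sqrtDiff A L * B = B * (sqrtDiff A L + A * A) * B := by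
    have : B * (A * A) * B = 1 := by rw [← mul_assoc, hBA, one_mul, hAB]
    rw [mul_add, add_mul, this, add_comm]
  rw [h1]
  set T := sqrtDiff A L + A * A with hT
  calc B * T * B * (A * A) * (B * T * B) = B * T * (B * A) * (A * B) * T * B := by
        simp only [mul_assoc]
    _ = B * (T * T) * B := by rw [hBA, hAB, mul_one, mul_one]; simp only [mul_assoc]
    _ = (B * A) * (L + A * A) * (A * B) := by
        rw [hT, sqrtDiff_add_mul_self hA hL]; simp only [mul_assoc]
    _ = _ := by rw [hBA, hAB, one_mul, mul_one]

/-- The energy operator collapses to z₀A² + A²z₀. Splitting R = Q² with Q Hilbert–Schmidt allows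
cyclic rotation, after which A and B cancel and each summand contributes Tr R. -/
theorem trace_minimizer {Y₀ : H →L[ℂ] H} (hA : IsSelfAdjoint A) (hAB : A * B = 1)
    (hBA : B * A = 1) (hL : 0 ≤ L) (hLt : FiniteTrace L)
    (hY₀ : (1 + B * sqrtDiff A L * B) * Y₀ = 1) (hLY₀ : DiagSummable (L * Y₀))
    (hHS : IsHilbertSchmidt (B * sqrtDiff A L * B)) :
    trace (A * A * (B * sqrtDiff A L * B) ^ 2 * Y₀) + trace (L * Y₀) =
      2 * trace (sqrtDiff A L) := by
  have hid := minimizer_identity (A * A) hY₀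
  rw [euler_lagrange hA hAB hBA hL, add_sub_cancel_left, add_sub_cancel_right] at hid
  rw [← trace_add (diagSummable_kinetic hHS _ _) hLY₀, hid]
  have hR0 := sqrtDiff_nonneg hA hL
  have hQ := isHilbertSchmidt_sqrt_sqrtDiff hA hBA hL hLt
  have hQQ := CFC.sqrt_mul_sqrt_self _ hR0
  set R := sqrtDiff A L
  set Q := CFC.sqrt R
  have e1 : B * R * B * (A * A) = B * Q * (Q * A) := by
    rw [← hQQ]
    calc B * (Q * Q) * B * (A * A) = B * Q * Q * (B * A) * A := by simp only [mul_assoc]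
      _ = _ := by rw [hBA, mul_one]; simp only [mul_assoc]
  have e2 : A * A * (B * R * B) = A * Q * (Q * B) := by
    rw [← hQQ]
    calc A * A * (B * (Q * Q) * B) = A * (A * B) * Q * Q * B := by simp only [mul_assoc]
      _ = _ := by rw [hAB, mul_one]; simp only [mul_assoc]
  rw [e1, e2, trace_add (diagSummable_mul (hQ.mul_left B) (hQ.mul_right A))
    (diagSummable_mul (hQ.mul_left A) (hQ.mul_right B)),
    trace_mul_comm (hQ.mul_left B) (hQ.mul_right A),
    trace_mul_comm (hQ.mul_left A) (hQ.mul_right B),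
    show Q * A * (B * Q) = Q * (A * B) * Q by simp only [mul_assoc],
    show Q * B * (A * Q) = Q * (B * A) * Q by simp only [mul_assoc], hAB, hBA, mul_one, hQQ]
  ring

end Minimizer

/-! ### Multiplication operators on the momentum shell -/

namespace Model

variable (M : Model)

theorem coeFn_mulOp {m : E3 × Bool → ℂ} (hm : MemLp m ∞ M.μ) (f : M.Photon) :
    M.mulOp m hm f =ᵐ[M.μ] fun p => m p * f p := by
  have h := ContinuousLinearMap.coeFn_holder (r := 2) (ContinuousLinearMap.mul ℂ ℂ) hm.toLp f
  filter_upwards [h, hm.coeFn_toLp] with p hp hp'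
  rw [← hp']
  exact hp

theorem mulOp_mul_mulOp {m n l : E3 × Bool → ℂ} (hm : MemLp m ∞ M.μ) (hn : MemLp n ∞ M.μ)
    (hl : MemLp l ∞ M.μ) (h : ∀ p ∈ M.shell, m p * n p = l p) :
    M.mulOp m hm * M.mulOp n hn = M.mulOp l hl := by
  ext1 f
  refine Lp.ext ?_
  rw [mul_apply_eq_comp]
  filter_upwards [M.coeFn_mulOp hm (M.mulOp n hn f), M.coeFn_mulOp hn f, M.coeFn_mulOp hl f,
    M.ae_mem_shell] with p h1 h2 h3 hp
  rw [h1, h2, h3, ← h p hp, mul_assoc]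

theorem mulOp_eq_one {m : E3 × Bool → ℂ} (hm : MemLp m ∞ M.μ) (h : ∀ p, m p = 1) :
    M.mulOp m hm = 1 := by
  ext1 f
  refine Lp.ext ?_
  filter_upwards [M.coeFn_mulOp hm f] with p h1
  rw [h1, h p, one_mul, one_apply_eq_self]

theorem isSelfAdjoint_mulOp {m : E3 × Bool → ℝ} (hm : MemLp (fun p => (m p : ℂ)) ∞ M.μ) :
    IsSelfAdjoint (M.mulOp (fun p => (m p : ℂ)) hm) := by
  rw [ContinuousLinearMap.isSelfAdjoint_iff_isSymmetric]
  intro f g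
  simp only [ContinuousLinearMap.coe_coe]
  rw [L2.inner_def, L2.inner_def]
  refine integral_congr_ae ?_
  filter_upwards [M.coeFn_mulOp hm f, M.coeFn_mulOp hm g] with p h1 h2
  rw [h1, h2, ← smul_eq_mul, ← smul_eq_mul, inner_smul_left, inner_smul_right, Complex.conj_ofReal]

theorem absKPow_mul_absKPow (s t : ℝ) : M.absKPow s * M.absKPow t = M.absKPow (s + t) := by
  refine M.mulOp_mul_mulOp _ _ _ fun p hp => ?_
  rw [← Complex.ofReal_mul, Real.rpow_add (M.cutoff_pos.trans_le hp.1)]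

theorem absKPow_zero : M.absKPow 0 = 1 :=
  M.mulOp_eq_one _ fun p => by rw [Real.rpow_zero, Complex.ofReal_one]

theorem isSelfAdjoint_absKPow (s : ℝ) : IsSelfAdjoint (M.absKPow s) := M.isSelfAdjoint_mulOp _

theorem isSelfAdjoint_coordK (ν : Fin 3) : IsSelfAdjoint (M.coordK ν) := M.isSelfAdjoint_mulOp _

theorem absKPow_half_mul_neg_half : M.absKPow (1 / 2) * M.absKPow (-(1 / 2)) = 1 := by
  rw [absKPow_mul_absKPow, add_neg_cancel, absKPow_zero]

theorem absKPow_neg_half_mul_half : M.absKPow (-(1 / 2)) * M.absKPow (1 / 2) = 1 := by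
  rw [absKPow_mul_absKPow, neg_add_cancel, absKPow_zero]

theorem absK_eq : M.absK = M.absKPow (1 / 2) * M.absKPow (1 / 2) := by
  rw [absKPow_mul_absKPow, add_halves, absK]

/-- The infrared cutoff enters through the boundedness of |k|^{-1/2}. -/
theorem absK_coercive : ∃ c : ℝ, 0 < c ∧ ∀ x, c * ‖x‖ ^ 2 ≤ (⟪x, M.absK x⟫_ℂ).re := by
  rw [absK_eq]
  exact ⟨_, by positivity,
    coercive_mul_self (M.isSelfAdjoint_absKPow _) M.absKPow_neg_half_mul_half⟩

theorem Λ_pos : 0 < M.Λ := zero_lt_one.trans_le M.one_le_Λ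

/-! ### Minimization in z -/

/-- The operator `Λ P_η`. -/
def scaledP (η : M.Photon) : M.Photon →L[ℂ] M.Photon := (M.Λ : ℂ) • M.P η

theorem hasSum_scaledP_mul (η : M.Photon) (Y : M.Photon →L[ℂ] M.Photon) :
    HasSum (fun i => ⟪stdBasis M.Photon i, (M.scaledP η * Y) (stdBasis M.Photon i)⟫_ℂ)
      (M.Λ * (2 * ∑ ν : Fin 3, ⟪M.shifted η ν, Y (M.shifted η ν)⟫_ℂ)) := by
  have h := ((hasSum_sum fun ν (_ : ν ∈ Finset.univ) =>
    hasSum_rankOne_mul (M.shifted η ν) (M.shifted η ν) Y).mul_left 2).mul_left (M.Λ : ℂ)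
  refine h.congr_fun fun i => ?_
  simp only [scaledP, P, smul_mul_assoc, Finset.sum_mul, smul_apply, inner_smul_right,
    sum_apply, inner_sum]

theorem diagSummable_scaledP_mul (η : M.Photon) (Y : M.Photon →L[ℂ] M.Photon) :
    DiagSummable (M.scaledP η * Y) := (M.hasSum_scaledP_mul η Y).summable

theorem finiteTrace_scaledP (η : M.Photon) : FiniteTrace (M.scaledP η) := by
  have h := Complex.hasSum_re (M.hasSum_scaledP_mul η 1)
  rw [mul_one] at h
  exact h.summable

open scoped ComplexOrder in
theorem scaledP_nonneg (η : M.Photon) : 0 ≤ M.scaledP η := by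
  rw [ContinuousLinearMap.nonneg_iff_isPositive]
  refine ContinuousLinearMap.IsPositive.smul_of_nonneg ?_ (by exact_mod_cast M.Λ_pos.le)
  refine ContinuousLinearMap.IsPositive.smul_of_nonneg ?_ zero_le_two
  exact ContinuousLinearMap.isPositive_sum _ fun ν _ =>
    InnerProductSpace.isPositive_rankOne_self _

/-- Brings the energy into the abstract form with A = |k|^{1/2} and L = ΛP_η; the factor 2 in P_η
turns Λ²/2 into Λ/4. -/
theorem energy_eq (z : M.Photon →L[ℂ] M.Photon) (η : M.Photon) :
    M.energy z η = M.Λ / 4 * ((trace (M.absKPow (1 / 2) * M.absKPow (1 / 2) * z ^ 2 *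
      Ring.inverse (1 + z))).re + (trace (M.scaledP η * Ring.inverse (1 + z))).re)
      + M.Λ * (⟪η, M.absK η⟫_ℂ).re := by
  have h : trace (M.scaledP η * Ring.inverse (1 + z)) = _ :=
    (M.hasSum_scaledP_mul η (Ring.inverse (1 + z))).tsum_eq
  rw [h, energy, kinetic, absK_eq, Complex.re_ofReal_mul,
    show (2 : ℂ) = ((2 : ℝ) : ℂ) by norm_num, Complex.re_ofReal_mul, Complex.re_sum]
  ring

theorem reducedOp_eq (η : M.Photon) :
    M.reducedOp η = sqrtDiff (M.absKPow (1 / 2)) (M.scaledP η) := by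
  rw [reducedOp, opSqrt, sqrtDiff, absK_eq, scaledP, mul_add, add_mul, mul_smul_comm,
    smul_mul_assoc, pow_two]
  simp only [mul_assoc]

theorem zStar_eq (η : M.Photon) : M.zStar η = M.absKPow (-(1 / 2)) *
    sqrtDiff (M.absKPow (1 / 2)) (M.scaledP η) * M.absKPow (-(1 / 2)) := by
  rw [zStar, opSqrt, absK_eq]
  exact minimizer_eq_conj M.absKPow_half_mul_neg_half M.absKPow_neg_half_mul_half

theorem zStar_nonneg (η : M.Photon) : 0 ≤ M.zStar η := by
  rw [zStar_eq]
  exact conj_nonneg (M.isSelfAdjoint_absKPow _)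
    (sqrtDiff_nonneg (M.isSelfAdjoint_absKPow _) (M.scaledP_nonneg η))

theorem isTraceClass_zStar (η : M.Photon) : IsTraceClass (M.zStar η) := by
  refine isTraceClass_of_nonneg (M.zStar_nonneg η) ?_
  rw [zStar_eq]
  exact finiteTrace_conj_sqrtDiff (M.isSelfAdjoint_absKPow _) (M.isSelfAdjoint_absKPow _)
    M.absKPow_neg_half_mul_half (M.scaledP_nonneg η) (M.finiteTrace_scaledP η)

theorem isHilbertSchmidt_zStar (η : M.Photon) : IsHilbertSchmidt (M.zStar η) := by
  rw [zStar_eq]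
  exact isHilbertSchmidt_conj_sqrtDiff (M.isSelfAdjoint_absKPow _) (M.isSelfAdjoint_absKPow _)
    M.absKPow_neg_half_mul_half (M.scaledP_nonneg η) (M.finiteTrace_scaledP η)

theorem zStar_mem {ε : ℝ} (hε : 0 ≤ ε) (η : M.Photon) : M.zStar η ∈ HSge M.Photon ε :=
  mem_HSge_of_nonneg hε (M.isHilbertSchmidt_zStar η) (M.zStar_nonneg η)

theorem isTraceClass_reducedOp (η : M.Photon) : IsTraceClass (M.reducedOp η) := by
  rw [reducedOp_eq]
  exact isTraceClass_of_nonneg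
    (sqrtDiff_nonneg (M.isSelfAdjoint_absKPow _) (M.scaledP_nonneg η))
    (finiteTrace_sqrtDiff (M.isSelfAdjoint_absKPow _) M.absKPow_neg_half_mul_half
      (M.scaledP_nonneg η) (M.finiteTrace_scaledP η))

theorem isUnit_one_add {ε : ℝ} (hε : ε < 1) {z : M.Photon →L[ℂ] M.Photon}
    (hz : z ∈ HSge M.Photon ε) : IsUnit (1 + z) :=
  isUnit_of_coercive (sub_pos.2 hε) (HSge.coercive hz)

theorem energy_zStar (η : M.Photon) : M.energy (M.zStar η) η =
    M.Λ / 2 * (trace (M.reducedOp η)).re + M.Λ * (⟪η, M.absK η⟫_ℂ).re := by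
  -- Positivity of z_* allows the lower bound ε = 0 here.
  have hu := M.isUnit_one_add zero_lt_one (M.zStar_mem le_rfl η)
  have hHS := M.isHilbertSchmidt_zStar η
  have h1 := Ring.mul_inverse_cancel _ hu
  have hd := M.diagSummable_scaledP_mul η (Ring.inverse (1 + M.zStar η))
  rw [energy_eq, ← Complex.add_re, reducedOp_eq]
  rw [zStar_eq] at *
  rw [trace_minimizer (M.isSelfAdjoint_absKPow _) M.absKPow_half_mul_neg_half
    M.absKPow_neg_half_mul_half (M.scaledP_nonneg η) (M.finiteTrace_scaledP η) h1 hd hHS,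
    show (2 : ℂ) = ((2 : ℝ) : ℂ) by norm_num, Complex.re_ofReal_mul]
  ring

theorem energy_zStar_lt {ε : ℝ} (hε0 : 0 ≤ ε) (hε : ε < 1) {z : M.Photon →L[ℂ] M.Photon}
    (hz : z ∈ HSge M.Photon ε) (η : M.Photon) (hne : z ≠ M.zStar η) :
    M.energy (M.zStar η) η < M.energy z η := by
  have hz₀ := M.zStar_mem hε0 η
  have hu := M.isUnit_one_add hε hz
  have hu₀ := M.isUnit_one_add hε hz₀
  have h1 := Ring.mul_inverse_cancel _ hu
  have hEL : (1 + M.zStar η) * (M.absKPow (1 / 2) * M.absKPow (1 / 2)) * (1 + M.zStar η) =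
      M.scaledP η + M.absKPow (1 / 2) * M.absKPow (1 / 2) := by
    rw [zStar_eq]
    exact euler_lagrange (M.isSelfAdjoint_absKPow _) M.absKPow_half_mul_neg_half
      M.absKPow_neg_half_mul_half (M.scaledP_nonneg η)
  have hcmp := congrArg Complex.re (trace_comparison hz.1 hz₀.1 h1 (Ring.inverse_mul_cancel _ hu)
    (Ring.mul_inverse_cancel _ hu₀) (Ring.inverse_mul_cancel _ hu₀) hEL
    (M.diagSummable_scaledP_mul η _) (M.diagSummable_scaledP_mul η _))
  have hpos := re_trace_conj_pos (M.isSelfAdjoint_absKPow (1 / 2)) M.absKPow_half_mul_neg_half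
    (hz₀.2.1.sub hz.2.1) (hz₀.1.sub hz.1) (sub_ne_zero.2 hne.symm)
    (re_inner_inverse_pos (sub_pos.2 hε) (HSge.coercive hz) h1)
  simp only [Complex.add_re] at hcmp
  rw [energy_eq, energy_eq, hcmp]
  have := M.Λ_pos
  nlinarith [mul_pos M.Λ_pos hpos]

theorem energy_zStar_le {ε : ℝ} (hε0 : 0 ≤ ε) (hε : ε < 1) {z : M.Photon →L[ℂ] M.Photon}
    (hz : z ∈ HSge M.Photon ε) (η : M.Photon) : M.energy (M.zStar η) η ≤ M.energy z η := by
  rcases eq_or_ne z (M.zStar η) with rfl | h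
  · exact le_rfl
  · exact (M.energy_zStar_lt hε0 hε hz η h).le

theorem energy_zStar_nonneg (η : M.Photon) : 0 ≤ M.energy (M.zStar η) η := by
  obtain ⟨c, hc, h⟩ := M.absK_coercive
  have h1 : 0 ≤ (trace (M.reducedOp η)).re := by
    rw [reducedOp_eq]
    exact re_trace_sqrtDiff_nonneg (M.isSelfAdjoint_absKPow _) M.absKPow_neg_half_mul_half
      (M.scaledP_nonneg η) (M.finiteTrace_scaledP η)
  have h2 : 0 ≤ (⟪η, M.absK η⟫_ℂ).re := (by positivity : 0 ≤ c * ‖η‖ ^ 2).trans (h η)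
  have := M.Λ_pos
  rw [energy_zStar]
  positivity

/-! ### Minimization in η -/

theorem re_inner_inverse_nonneg {ε : ℝ} (hε : ε < 1) {z : M.Photon →L[ℂ] M.Photon}
    (hz : z ∈ HSge M.Photon ε) (x : M.Photon) : 0 ≤ (⟪x, Ring.inverse (1 + z) x⟫_ℂ).re := by
  rcases eq_or_ne x 0 with rfl | hx
  · simp
  · exact (re_inner_inverse_pos (sub_pos.2 hε) (HSge.coercive hz)
      (Ring.mul_inverse_cancel _ (M.isUnit_one_add hε hz)) x hx).le

theorem re_inner_hessian (z : M.Photon →L[ℂ] M.Photon) (x y : M.Photon) :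
    (⟪x, M.hessian z y⟫_ℂ).re = 2 * M.Λ * (⟪x, M.absK y⟫_ℂ).re +
      M.Λ ^ 2 * ∑ ν : Fin 3, (⟪M.coordK ν x, Ring.inverse (1 + z) (M.coordK ν y)⟫_ℂ).re := by
  simp only [hessian, add_apply, smul_apply, sum_apply, inner_add_right, inner_smul_right,
    inner_sum, Complex.add_re, Complex.re_ofReal_mul, Complex.re_sum, mul_apply_eq_comp,
    inner_apply_eq_of_isSelfAdjoint (M.isSelfAdjoint_coordK _)]

/-- The |k| term alone suffices, the other being nonnegative; hence c does not depend on z or ε. -/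
theorem hessian_coercive : ∃ c : ℝ, 0 < c ∧ ∀ ε < (1 : ℝ), ∀ z ∈ HSge M.Photon ε,
    ∀ x, c * ‖x‖ ^ 2 ≤ (⟪x, M.hessian z x⟫_ℂ).re := by
  obtain ⟨c, hc, h⟩ := M.absK_coercive
  refine ⟨2 * M.Λ * c, by have := M.Λ_pos; positivity, fun ε hε z hz x => ?_⟩
  rw [re_inner_hessian]
  have h1 : 0 ≤ M.Λ ^ 2 * ∑ ν : Fin 3,
      (⟪M.coordK ν x, Ring.inverse (1 + z) (M.coordK ν x)⟫_ℂ).re :=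
    mul_nonneg (sq_nonneg _) (Finset.sum_nonneg fun ν _ => M.re_inner_inverse_nonneg hε hz _)
  have h2 := mul_le_mul_of_nonneg_left (h x) (mul_nonneg zero_le_two M.Λ_pos.le)
  linarith

theorem isUnit_hessian {ε : ℝ} (hε : ε < 1) {z : M.Photon →L[ℂ] M.Photon}
    (hz : z ∈ HSge M.Photon ε) : IsUnit (M.hessian z) := by
  obtain ⟨c, hc, h⟩ := M.hessian_coercive
  exact isUnit_of_coercive hc (h ε hε z hz)

/-- An exact second-order expansion: the linear term is the real gradient, which vanishes at η_*,
and the remainder is half the Hessian form. -/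
theorem energy_add {ε : ℝ} (hε : ε < 1) {z : M.Photon →L[ℂ] M.Photon}
    (hz : z ∈ HSge M.Photon ε) (η d : M.Photon) :
    M.energy z (η + d) = M.energy z η + (⟪d, M.hessian z η + ((M.Λ ^ 2 : ℝ) : ℂ) •
      ∑ ν : Fin 3, M.coordK ν (Ring.inverse (1 + z) (M.coupling ν))⟫_ℂ).re +
      1 / 2 * (⟪d, M.hessian z d⟫_ℂ).re := by
  have hY := isSelfAdjoint_inverse ((IsSelfAdjoint.one _).add hz.2.1) (M.isUnit_one_add hε hz)
  have hK : IsSelfAdjoint M.absK := M.isSelfAdjoint_absKPow 1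
  have hs : ∀ ν, M.shifted (η + d) ν = M.shifted η ν + M.coordK ν d := fun ν => by
    rw [shifted, shifted, map_add, add_assoc]
  have ht : ∀ ν, (⟪M.coordK ν d, Ring.inverse (1 + z) (M.shifted η ν)⟫_ℂ).re =
      (⟪M.coordK ν d, Ring.inverse (1 + z) (M.coupling ν)⟫_ℂ).re +
      (⟪M.coordK ν d, Ring.inverse (1 + z) (M.coordK ν η)⟫_ℂ).re := fun ν => by
    rw [shifted, map_add, inner_add_right, Complex.add_re]
  rw [energy, energy, inner_add_right, Complex.add_re, re_inner_hessian, re_inner_hessian,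
    re_inner_add_add hK]
  simp only [hs, re_inner_add_add hY, ht, inner_smul_right, inner_sum, Complex.re_ofReal_mul,
    Complex.re_sum, inner_apply_eq_of_isSelfAdjoint (M.isSelfAdjoint_coordK _),
    Finset.sum_add_distrib, ← Finset.mul_sum]
  ring

theorem hessian_etaStar {z : M.Photon →L[ℂ] M.Photon} (hu : IsUnit (M.hessian z)) :
    M.hessian z (M.etaStar z) + ((M.Λ ^ 2 : ℝ) : ℂ) •
      ∑ ν : Fin 3, M.coordK ν (Ring.inverse (1 + z) (M.coupling ν)) = 0 := by
  rw [etaStar, map_neg, ← mul_apply_eq_comp (M.hessian z), Ring.mul_inverse_cancel _ hu,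
    one_apply_eq_self, neg_add_cancel]

theorem energy_etaStar_lt {ε : ℝ} (hε : ε < 1) {z : M.Photon →L[ℂ] M.Photon}
    (hz : z ∈ HSge M.Photon ε) (η : M.Photon) (hne : η ≠ M.etaStar z) :
    M.energy z (M.etaStar z) < M.energy z η := by
  obtain ⟨c, hc, h⟩ := M.hessian_coercive
  have h1 := M.energy_add hε hz (M.etaStar z) (η - M.etaStar z)
  rw [add_sub_cancel, M.hessian_etaStar (M.isUnit_hessian hε hz), inner_zero_right,
    Complex.zero_re, add_zero] at h1
  have h2 := h ε hε z hz (η - M.etaStar z)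
  have h3 : 0 < c * ‖η - M.etaStar z‖ ^ 2 :=
    mul_pos hc (pow_pos (norm_pos_iff.2 (sub_ne_zero.2 hne)) 2)
  linarith

/-! ### The reduced problem and the main theorem -/

theorem bddBelow_energyValues {ε : ℝ} (hε0 : 0 ≤ ε) (hε : ε < 1) :
    BddBelow (M.energyValues ε) := by
  refine ⟨0, ?_⟩
  rintro _ ⟨z, hz, η, rfl⟩
  exact (M.energy_zStar_nonneg η).trans (M.energy_zStar_le hε0 hε hz η)

theorem minEnergy_eq {ε : ℝ} (hε0 : 0 ≤ ε) (hε : ε < 1) :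
    M.minEnergy ε = ⨅ η : M.Photon, M.energy (M.zStar η) η := by
  refine le_antisymm (le_ciInf fun η => csInf_le (M.bddBelow_energyValues hε0 hε)
    ⟨M.zStar η, M.zStar_mem hε0 η, η, rfl⟩) ?_
  refine le_csInf ⟨_, M.zStar 0, M.zStar_mem hε0 0, 0, rfl⟩ ?_
  rintro _ ⟨z, hz, η, rfl⟩
  refine (ciInf_le ⟨0, ?_⟩ η).trans (M.energy_zStar_le hε0 hε hz η)
  rintro _ ⟨η', rfl⟩
  exact M.energy_zStar_nonneg η'

end Model
end BHF
end

theorem mainTheorem2 (M : BHF.Model) (ε : ℝ) (hε0 : 0 < ε) (hε1 : ε < 1) :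
    -- the functional is well defined on `HS_ε`
    (∀ z ∈ BHF.HSge M.Photon ε, IsUnit (1 + z) ∧ BHF.IsTraceClass (M.kinetic z)) ∧
    -- the unique partial minimizer in `z`
    (∀ η : M.Photon, 0 ≤ M.zStar η ∧ BHF.IsTraceClass (M.zStar η) ∧
      BHF.IsUniqueMinimizer (fun z => M.energy z η) (BHF.HSge M.Photon ε) (M.zStar η)) ∧
    -- the unique partial minimizer in `η`
    (∀ z ∈ BHF.HSge M.Photon ε, IsUnit (M.hessian z) ∧
      BHF.IsUniqueMinimizer (fun η => M.energy z η) Set.univ (M.etaStar z)) ∧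
    -- the fixed point equation for minimizing pairs
    (∀ z ∈ BHF.HSge M.Photon ε, ∀ η : M.Photon,
      (∀ z' ∈ BHF.HSge M.Photon ε, ∀ η' : M.Photon, M.energy z η ≤ M.energy z' η') →
        z = M.zStar η ∧ η = M.etaStar z) ∧
    -- the reduced minimization problem
    (BddBelow (M.energyValues ε) ∧ M.minEnergy ε = ⨅ η : M.Photon, M.energy (M.zStar η) η) ∧
    -- the explicit form of the reduced functional
    (∀ η : M.Photon, BHF.IsTraceClass (M.reducedOp η) ∧
      M.energy (M.zStar η) η =
        M.Λ / 2 * (BHF.trace (M.reducedOp η)).re + M.Λ * (inner ℂ η (M.absK η)).re) := by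
  refine ⟨fun z hz => ⟨M.isUnit_one_add hε1 hz, BHF.isTraceClass_kinetic hz.1 _ _⟩,
    fun η => ⟨M.zStar_nonneg η, M.isTraceClass_zStar η, M.zStar_mem hε0.le η,
      fun z hz hne => M.energy_zStar_lt hε0.le hε1 hz η hne⟩,
    fun z hz => ⟨M.isUnit_hessian hε1 hz, Set.mem_univ _,
      fun η _ hne => M.energy_etaStar_lt hε1 hz η hne⟩,
    fun z hz η hmin => ⟨?_, ?_⟩,
    ⟨M.bddBelow_energyValues hε0.le hε1, M.minEnergy_eq hε0.le hε1⟩,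
    fun η => ⟨M.isTraceClass_reducedOp η, M.energy_zStar η⟩⟩
  -- A joint minimizer minimizes in each variable separately, so each component is the unique
  -- partial minimizer.
  · by_contra hne
    exact (M.energy_zStar_lt hε0.le hε1 hz η hne).not_ge (hmin _ (M.zStar_mem hε0.le η) η)
  · by_contra hne
    exact (M.energy_etaStar_lt hε1 hz η hne).not_ge (hmin z hz _)
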